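/- **Notation.** Let $M_0=\bigoplus_{i\ge 0}\mathbb Z b_i$ be the free abelian group with basis $b_0,b_1,\dots$ (and put $b_i=0$ for $i<0$), and let $r\ge 1$. Let $\mathcal G_r\subseteq\bigwedge^rM_0$ be the Grassmann cone, i.e. the set of all $m_1\wedge\cdots\wedge m_r$ with $m_1,\dots,m_r\in M_0$. Let $\mathcal P_r$ be the set of partitions $\lambda=(\lambda_1\ge\cdots\ge\lambda_r\ge 0)$; we regard $\mathcal P_r\subseteq\mathcal P_{r+1}$ by appending a part $0$. For $\lambda\in\mathcal P_r$ put $[\mathbf b]^r_\lambda=b_{\lambda_r}\wedge b_{1+\lambda_{r-1}}\wedge\cdots\wedge b_{r-1+\lambda_1}$; these elements form a $\mathbb Z$-basis of $\bigwedge^rM_0$. For $s\ge 0$ let $B_s=\mathbb Z[e_1,\dots,e_s]$ (so $B_0=\mathbb Z$), $E_s(z)=1-e_1z+\cdots+(-1)^se_sz^s$, and let $H_s=(h_n)_{n\in\mathbb Z}$ be the sequence in $B_s$ with $\sum_{n}h_nz^n=1/E_s(z)$ in $B_s[[z]]$ (so $h_n=0$ for $n<0$). For $\lambda\in\mathcal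 P_r$ and a sequence $(g_n)_{n\in\mathbb Z}$ in a commutative ring put $\Delta_\lambda(g)=\det(g_{\lambda_j-j+i})_{1\le i,j\le r}$. The elements $\Delta_\lambda(H_s)$, $\lambda\in\mathcal P_s$, form a $\mathbb Z$-basis of $B_s$, and $\phi_s:B_s\to\bigwedge^sM_0$ denotes the isomorphism of abelian groups with $\phi_s(\Delta_\lambda(H_s))=[\mathbf b]^s_\lambda$. Let $\sigma_-(z):\bigwedge M_0\to(\bigwedge M_0)[z^{-1}]$ be the unique homomorphism of $\mathbb Z$-algebras with $\sigma_-(z)b_j=\sum_{i\ge 0}b_{j-i}z^{-i}$, and let $\overline\sigma_-(z)$ be its inverse in $\mathrm{End}_{\mathbb Z}(\bigwedge M_0)[[z^{-1}]]$, i.e. the unique homomorphism of $\mathbb Z$-algebras with $\overline\sigma_-(z)b_j=b_j-b_{j-1}z^{-1}$. Both are regarded as maps $B_s\to B_s[z^{-1}]$ through $\phi_s$, i.e. $p\mapsto\phi_s^{-1}(\sigma_-(z)\phi_s(p))$ and $p\mapsto\phi_s^{-1}(\overline\sigma_-(z)\phi_s(p))$. Let $\sigma_-(z)H_s=(\sigma_-(z)h_n)_{n\in\mathbb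 Z}$ for $s\ge 1$; for $s=0$, by convention, the $n$-th term of $\sigma_-(z)H_0$ is $z^{-n}$ if $n\ge 0$ and $0$ if $n<0$. Finally, $\mathrm{Res}_z$ is the coefficient of $z^{-1}$ of a Laurent series in $z$, and for $f=\sum_if_iz^i$ and $g=\sum_jg_jz^j$ we write $f\otimes g=\sum_{i,j}(f_i\otimes g_j)z^{i+j}$. **Theorem.** Let $r\ge 1$ and let $\mathbf m=\sum_{\lambda\in\mathcal P_r}a_\lambda[\mathbf b]^r_\lambda\in\bigwedge^rM_0$, with integers $a_\lambda$, all but finitely many of them zero. Then $\mathbf m\in\mathcal G_r$ if and only if $$\mathrm{Res}_z\sum_{\lambda,\mu\in\mathcal P_r}a_\lambda a_\mu\;E_{r-1}(z)\,\Delta_\lambda(\sigma_-(z)H_{r-1})\otimes\frac1{E_{r+1}(z)}\,\overline\sigma_-(z)\Delta_\mu(H_{r+1})=0$$ in $B_{r-1}\otimes_{\mathbb Z}B_{r+1}$. -/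

import Mathlib

open scoped TensorProduct

namespace SchubertCone

noncomputable section

/-! ### Partitions, Schur determinants, and the two bases -/

/-- Partitions `λ₁ ≥ ⋯ ≥ λ_r ≥ 0` with at most `r` parts; `λ_j` is `lam.1 (j - 1)`. -/
def Ptn (r : ℕ) : Type := {lam : Fin r → ℕ // Antitone lam}

/-- A partition with at most `r` parts, seen as one with at most `r + 1` parts. -/
def Ptn.succ {r : ℕ} (lam : Ptn r) : Ptn (r + 1) :=
  ⟨Fin.snoc (α := fun _ => ℕ) lam.1 0, by
    intro i j hij
    induction j using Fin.lastCases with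
    | last => simp
    | cast j =>
      induction i using Fin.lastCases with
      | last => exact absurd hij (by simp [Fin.le_def, j.isLt])
      | cast i => simpa using lam.2 (by simpa using hij)⟩

/-- The strictly increasing sequence `λ_r < 1 + λ_{r-1} < ⋯ < r - 1 + λ₁`. -/
def Ptn.index {r : ℕ} (lam : Ptn r) (k : Fin r) : ℕ := (k : ℕ) + lam.1 k.rev

/-- The Schur determinant `det (h_{λ_j - j + i})` of a bilateral sequence. -/
def schurDet {R : Type*} [CommRing R] {r : ℕ} (lam : Ptn r) (h : ℤ → R) : R :=
  Matrix.det (Matrix.of fun i j : Fin r => h ((lam.1 j : ℤ) - (j : ℤ) + (i : ℤ)))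

/-- `B_r = ℤ[e₁, …, e_r]`; the indeterminate `e_j` is `X (j - 1)`. -/
abbrev B (r : ℕ) : Type := MvPolynomial (Fin r) ℤ

/-- `E_r(z) = 1 - e₁ z + ⋯ + (-1)^r e_r z^r`. -/
def E (r : ℕ) : PowerSeries (B r) :=
  1 + ∑ j : Fin r, PowerSeries.monomial ((j : ℕ) + 1) ((-1) ^ ((j : ℕ) + 1) * MvPolynomial.X j)

/-- `1 / E_r(z) = ∑ₙ (1 - E_r(z))ⁿ`. -/
def invE (r : ℕ) : PowerSeries (B r) := PowerSeries.invOfUnit (E r) 1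

/-- The bilateral sequence `H_r = (h_n)` of coefficients of `1 / E_r(z)`. -/
def h (r : ℕ) (n : ℤ) : B r := if 0 ≤ n then PowerSeries.coeff n.toNat (invE r) else 0

theorem constantCoeff_E (r : ℕ) : PowerSeries.constantCoeff (E r) = 1 := by
  rw [← PowerSeries.coeff_zero_eq_constantCoeff_apply, E, map_add, map_sum]
  simp only [PowerSeries.coeff_monomial]
  simp

theorem E_mul_invE (r : ℕ) : E r * invE r = 1 :=
  PowerSeries.mul_invOfUnit _ _ (by simp [constantCoeff_E])

theorem h_natCast (r n : ℕ) : h r (n : ℤ) = PowerSeries.coeff n (invE r) := by simp [h]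

theorem h_zero (r : ℕ) : h r 0 = 1 := by
  have := h_natCast r 0
  simpa [invE] using this

theorem h_neg (r : ℕ) {n : ℤ} (hn : n < 0) : h r n = 0 := by simp [h, hn]

theorem Ptn.index_strictMono {r : ℕ} (lam : Ptn r) : StrictMono lam.index := by
  intro i j hij
  have h1 := lam.2 (Fin.rev_le_rev.mpr hij.le)
  have h2 : (i : ℕ) < j := hij
  simp only [Ptn.index]
  omega

theorem Ptn.ext_index {r : ℕ} {lam mu : Ptn r} (hlm : lam.index = mu.index) : lam = mu := by
  apply Subtype.ext
  funext j
  have := congrFun hlm j.rev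
  simpa [Ptn.index] using this

theorem strictMono_sub {r : ℕ} {f : Fin r → ℕ} (hf : StrictMono f) {i j : Fin r} (hij : i ≤ j) :
    f i + ((j : ℕ) - i) ≤ f j := by
  obtain ⟨i, hi⟩ := i
  obtain ⟨j, hj⟩ := j
  simp only [Fin.mk_le_mk] at hij
  induction j, hij using Nat.le_induction with
  | base => simp
  | succ k hk ih =>
    have h1 := ih (by omega)
    have h2 : f ⟨k, by omega⟩ < f ⟨k + 1, hj⟩ := hf (by simp [Fin.lt_def])
    simp only at h1 ⊢
    omega

theorem strictMono_ge {r : ℕ} {f : Fin r → ℕ} (hf : StrictMono f) (j : Fin r) : (j : ℕ) ≤ f j := by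
  have := strictMono_sub hf (i := ⟨0, j.pos⟩) (j := j) (by simp [Fin.le_def])
  simp only at this
  omega

theorem exists_ptn {r : ℕ} {f : Fin r → ℕ} (hf : StrictMono f) : ∃ lam : Ptn r, lam.index = f := by
  refine ⟨⟨fun j => f j.rev - (j.rev : ℕ), ?_⟩, ?_⟩
  · intro i j hij
    have h1 := strictMono_sub hf (Fin.rev_le_rev.mpr hij)
    have h2 := strictMono_ge hf j.rev
    have h3 : ((j.rev : Fin r) : ℕ) ≤ (i.rev : Fin r) := Fin.rev_le_rev.mpr hij
    simp only
    omega
  · funext k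
    have := strictMono_ge hf k
    simp only [Ptn.index, Fin.rev_rev]
    omega

/-- The partitions with at most `r` parts correspond to the increasing sequences of length `r`. -/
def ptnEquiv (r : ℕ) : Ptn r ≃ (Fin r ↪o ℕ) :=
  Equiv.ofBijective (fun lam => OrderEmbedding.ofStrictMono lam.index lam.index_strictMono) <| by
    refine ⟨fun lam mu hlm => Ptn.ext_index ?_, fun f => ?_⟩
    · funext k
      exact congrArg (fun g : Fin r ↪o ℕ => g k) hlm
    · obtain ⟨lam, hlam⟩ := exists_ptn f.strictMono
      refine ⟨lam, ?_⟩
      ext k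
      exact congrFun hlam k

/-- The determinant `det (h_{f_b - l})`, for any sequence `f` of indices. -/
def hDet (r : ℕ) (f : Fin r → ℕ) : B r :=
  Matrix.det (Matrix.of fun l b : Fin r => h r ((f b : ℤ) - (l : ℤ)))

theorem hDet_index (r : ℕ) (lam : Ptn r) : hDet r lam.index = schurDet lam (h r) := by
  rw [hDet, schurDet, ← Matrix.det_submatrix_equiv_self (Fin.revPerm : Equiv.Perm (Fin r))]
  congr 1
  ext1 i j
  simp only [Matrix.submatrix_apply, Matrix.of_apply, Fin.revPerm_apply, Ptn.index, Fin.rev_rev]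
  congr 1
  simp only [Fin.val_rev]
  have := i.isLt
  have := j.isLt
  omega

/-- `e_j` as an elementary symmetric polynomial in `x₁, …, x_r`. -/
def theta (r : ℕ) : B r →ₐ[ℤ] MvPolynomial (Fin r) ℤ :=
  (Subalgebra.val _).comp (MvPolynomial.esymmAlgHom (Fin r) ℤ r)

theorem theta_injective (r : ℕ) : Function.Injective (theta r) :=
  Subtype.val_injective.comp (MvPolynomial.esymmAlgHom_injective ℤ (by simp))

theorem theta_X (r : ℕ) (j : Fin r) :
    theta r (MvPolynomial.X j) = MvPolynomial.esymm (Fin r) ℤ ((j : ℕ) + 1) := by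
  simp [theta, MvPolynomial.esymmAlgHom]

/-- The alternant `det (x_a ^ f_b)`. -/
def alt (r : ℕ) (f : Fin r → ℕ) : MvPolynomial (Fin r) ℤ :=
  Matrix.det (Matrix.of fun a b : Fin r => (MvPolynomial.X a : MvPolynomial (Fin r) ℤ) ^ f b)

theorem coeff_prod_one_sub {R : Type*} [CommRing R] {s : Type*} (S : Finset s) (x : s → R) (n : ℕ) :
    PowerSeries.coeff n (∏ c ∈ S, (1 - PowerSeries.C (x c) * PowerSeries.X)) =
      (-1) ^ n * ∑ t ∈ S.powersetCard n, ∏ i ∈ t, x i := by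
  classical
  have h1 : ∀ c, (1 - PowerSeries.C (x c) * PowerSeries.X : PowerSeries R)
      = 1 + PowerSeries.monomial 1 (- x c) := by
    intro c
    rw [sub_eq_add_neg]
    congr 1
    ext n
    simp [PowerSeries.coeff_monomial, PowerSeries.coeff_X]
  have h2 : ∀ t : Finset s, ∏ i ∈ t, (PowerSeries.monomial 1 (- x i) : PowerSeries R)
      = PowerSeries.monomial t.card ((-1) ^ t.card * ∏ i ∈ t, x i) := by
    intro t
    induction t using Finset.induction_on with
    | empty => simp
    | insert a t ha ih =>
      rw [Finset.prod_insert ha, ih, PowerSeries.monomial_mul_monomial, Finset.card_insert_of_notMem ha,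
        Finset.prod_insert ha, add_comm]
      congr 1
      ring
  simp_rw [h1, Finset.prod_one_add, h2, map_sum, PowerSeries.coeff_monomial]
  rw [Finset.powersetCard_eq_filter, Finset.sum_filter, Finset.mul_sum]
  refine Finset.sum_congr rfl fun t _ => ?_
  by_cases hn : t.card = n
  · simp [hn]
  · simp [hn, Ne.symm hn]

theorem map_theta_E (r : ℕ) : PowerSeries.map (theta r : B r →+* MvPolynomial (Fin r) ℤ) (E r) =
    ∏ c : Fin r, (1 - PowerSeries.C (MvPolynomial.X c) * PowerSeries.X) := by
  ext1 n
  rw [coeff_prod_one_sub]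
  rw [PowerSeries.coeff_map, E]
  simp only [map_add, map_sum, PowerSeries.coeff_monomial, PowerSeries.coeff_one]
  change _ = (-1) ^ n * MvPolynomial.esymm (Fin r) ℤ n
  rcases n with _ | n
  · simp
  · by_cases hn : n < r
    · rw [Finset.sum_eq_single (⟨n, hn⟩ : Fin r)]
      · simp [theta_X]
      · intro j _ hj
        have : (n : ℕ) ≠ j := fun h => hj (Fin.ext h.symm)
        simp [this]
      · simp
    · rw [Finset.sum_eq_zero]
      · simp only [MvPolynomial.esymm]
        rw [Finset.powersetCard_eq_empty.mpr (by simpa using Nat.lt_succ_of_le (not_lt.mp hn))]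
        simp
      · intro j _
        have : (n : ℕ) ≠ j := by have := j.isLt; omega
        simp [this]

/-- The transition matrix from the sequences `h` to the powers of the `x_a`. -/
def transMat (r : ℕ) : Matrix (Fin r) (Fin r) (MvPolynomial (Fin r) ℤ) :=
  Matrix.of fun a l => PowerSeries.coeff (l : ℕ)
    (∏ c ∈ Finset.univ.erase a, (1 - PowerSeries.C (MvPolynomial.X c) * PowerSeries.X))

theorem pow_eq_sum (r : ℕ) (a : Fin r) (n : ℕ) :
    (MvPolynomial.X a : MvPolynomial (Fin r) ℤ) ^ n =
      ∑ l : Fin r, transMat r a l * theta r (h r ((n : ℤ) - (l : ℤ))) := by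
  classical
  set P : PowerSeries (MvPolynomial (Fin r) ℤ) :=
    ∏ c ∈ Finset.univ.erase a, (1 - PowerSeries.C (MvPolynomial.X c) * PowerSeries.X) with hP
  set G : PowerSeries (MvPolynomial (Fin r) ℤ) := PowerSeries.mk fun n => MvPolynomial.X a ^ n with hG
  have hG1 : (1 - PowerSeries.C (MvPolynomial.X a) * PowerSeries.X) * G = 1 := by
    ext1 m
    rw [sub_mul, one_mul, mul_assoc, map_sub, PowerSeries.coeff_C_mul]
    rcases m with _ | m
    · simp [hG]
    · rw [PowerSeries.coeff_succ_X_mul]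
      simp [hG, PowerSeries.coeff_one, pow_succ']
  have hE : PowerSeries.map (theta r : B r →+* MvPolynomial (Fin r) ℤ) (E r) *
      PowerSeries.map (theta r : B r →+* MvPolynomial (Fin r) ℤ) (invE r) = 1 := by
    rw [← map_mul, E_mul_invE, map_one]
  have hGP : G = P * PowerSeries.map (theta r : B r →+* MvPolynomial (Fin r) ℤ) (invE r) := by
    rw [map_theta_E, ← Finset.mul_prod_erase _ _ (Finset.mem_univ a), ← hP] at hE
    calc G = G * ((1 - PowerSeries.C (MvPolynomial.X a) * PowerSeries.X) * P *
          PowerSeries.map (theta r : B r →+* MvPolynomial (Fin r) ℤ) (invE r)) := by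
            rw [hE, mul_one]
      _ = ((1 - PowerSeries.C (MvPolynomial.X a) * PowerSeries.X) * G) *
          (P * PowerSeries.map (theta r : B r →+* MvPolynomial (Fin r) ℤ) (invE r)) := by ring
      _ = _ := by rw [hG1, one_mul]
  have hdeg : ∀ m, r ≤ m → PowerSeries.coeff m P = 0 := by
    intro m hm
    rw [hP, coeff_prod_one_sub, Finset.powersetCard_eq_empty.mpr]
    · simp
    · rw [Finset.card_erase_of_mem (Finset.mem_univ a), Finset.card_univ, Fintype.card_fin]
      have := a.pos
      omega
  have h1 : (MvPolynomial.X a : MvPolynomial (Fin r) ℤ) ^ n = PowerSeries.coeff n G := by simp [hG]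
  rw [h1, hGP, PowerSeries.coeff_mul, Finset.Nat.sum_antidiagonal_eq_sum_range_succ_mk]
  have h2 : ∀ k ∈ Finset.range (n + 1), PowerSeries.coeff k P * PowerSeries.coeff (n - k)
      (PowerSeries.map (theta r : B r →+* MvPolynomial (Fin r) ℤ) (invE r)) =
      PowerSeries.coeff k P * theta r (h r ((n : ℤ) - (k : ℤ))) := by
    intro k hk
    have hk' : k ≤ n := by simpa [Nat.lt_succ_iff] using hk
    rw [PowerSeries.coeff_map, ← h_natCast, Nat.cast_sub hk']
    rfl
  rw [Finset.sum_congr rfl h2]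
  change _ = ∑ l : Fin r, PowerSeries.coeff (l : ℕ) P * theta r (h r ((n : ℤ) - ((l : ℕ) : ℤ)))
  rw [Fin.sum_univ_eq_sum_range
    (fun l => PowerSeries.coeff l P * theta r (h r ((n : ℤ) - (l : ℤ)))) r]
  rcases le_total r (n + 1) with hrn | hrn
  · symm
    apply Finset.sum_subset (Finset.range_mono hrn)
    intro k _ hk
    rw [hdeg k (by simpa using hk), zero_mul]
  · apply Finset.sum_subset (Finset.range_mono hrn)
    intro k _ hk
    rw [h_neg r (by have : n + 1 ≤ k := by simpa using hk
                    omega), map_zero, mul_zero]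

theorem alt_eq_mul (r : ℕ) (f : Fin r → ℕ) : alt r f = (transMat r).det * theta r (hDet r f) := by
  have h1 : theta r (hDet r f) =
      (Matrix.of fun l b : Fin r => theta r (h r ((f b : ℤ) - (l : ℤ)))).det := by
    rw [hDet, AlgHom.map_det]
    rfl
  rw [h1, ← Matrix.det_mul, alt]
  congr 1
  ext1 a b
  rw [Matrix.mul_apply]
  exact pow_eq_sum r a (f b)

theorem transMat_det_ne_zero (r : ℕ) : (transMat r).det ≠ 0 := by
  intro h0
  have h1 := alt_eq_mul r (fun b => (b : ℕ))
  rw [h0, zero_mul] at h1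
  have h2 : alt r (fun b => (b : ℕ)) =
      (Matrix.vandermonde (fun a : Fin r => (MvPolynomial.X a : MvPolynomial (Fin r) ℤ))).det := rfl
  rw [h2] at h1
  exact (Matrix.det_vandermonde_ne_zero_iff.mpr (MvPolynomial.X_injective)) h1

theorem alt_eq_sum (r : ℕ) (f : Fin r → ℕ) : alt r f = ∑ s : Equiv.Perm (Fin r),
    Equiv.Perm.sign s • MvPolynomial.monomial (Finsupp.equivFunOnFinite.symm (f ∘ s.symm)) (1 : ℤ) := by
  rw [alt, Matrix.det_apply]
  refine Finset.sum_congr rfl fun s _ => ?_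
  congr 1
  rw [MvPolynomial.monomial_eq, Finsupp.prod_fintype _ _ (by simp)]
  simp only [Matrix.of_apply, map_one, one_mul]
  rw [← Equiv.prod_comp s fun a => (MvPolynomial.X a : MvPolynomial (Fin r) ℤ) ^
    (Finsupp.equivFunOnFinite.symm (f ∘ s.symm)) a]
  simp

theorem coeff_alt (r : ℕ) {f g : Fin r → ℕ} (hf : StrictMono f) (hg : StrictMono g) :
    MvPolynomial.coeff (Finsupp.equivFunOnFinite.symm f) (alt r g) = if f = g then 1 else 0 := by
  classical
  rw [alt_eq_sum, MvPolynomial.coeff_sum]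
  have key : ∀ s : Equiv.Perm (Fin r), g ∘ s.symm = f → s = 1 := by
    intro s hs
    have hmono : StrictMono s.symm := by
      intro i j hij
      have := hf hij
      rw [← hs] at this
      exact hg.lt_iff_lt.mp this
    have h2 : (hmono.orderIsoOfSurjective _ s.symm.surjective) = OrderIso.refl (Fin r) :=
      Subsingleton.elim _ _
    ext i
    have h3 : s.symm (s i) = s i := congrArg (fun e : Fin r ≃o Fin r => e (s i)) h2
    rw [Equiv.symm_apply_apply] at h3
    simp [← h3]
  rw [Finset.sum_eq_single 1]
  · have : (g ∘ (1 : Equiv.Perm (Fin r)).symm) = g := rfl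
    rw [this]
    simp [MvPolynomial.coeff_monomial, eq_comm]
  · intro s _ hs
    have : g ∘ s.symm ≠ f := fun h => hs (key s h)
    have h2 : Finsupp.equivFunOnFinite.symm (g ∘ s.symm) ≠ Finsupp.equivFunOnFinite.symm f :=
      fun h => this (Finsupp.equivFunOnFinite.symm.injective h)
    rw [Units.smul_def, MvPolynomial.coeff_smul, MvPolynomial.coeff_monomial, if_neg h2, smul_zero]
  · simp

theorem schurDet_linearIndependent (r : ℕ) :
    LinearIndependent ℤ (fun lam : Ptn r => schurDet lam (h r)) := by
  have hlin : LinearIndependent ℤ (fun lam : Ptn r => alt r lam.index) := by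
    refine LinearIndependent.of_pairwise_dual_eq_zero_one _
      (fun lam => MvPolynomial.lcoeff ℤ (Finsupp.equivFunOnFinite.symm lam.index)) ?_ ?_
    · intro lam mu hlm
      simp only [MvPolynomial.lcoeff_apply]
      rw [coeff_alt r lam.index_strictMono mu.index_strictMono,
        if_neg fun hh => hlm (Ptn.ext_index hh)]
    · intro lam
      simp only [MvPolynomial.lcoeff_apply]
      rw [coeff_alt r lam.index_strictMono lam.index_strictMono, if_pos rfl]
  refine LinearIndependent.of_comp
    ((LinearMap.mulLeft ℤ (transMat r).det).comp (theta r).toLinearMap) ?_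
  have heq : (⇑((LinearMap.mulLeft ℤ (transMat r).det).comp (theta r).toLinearMap) ∘
      fun lam : Ptn r => schurDet lam (h r)) = fun lam : Ptn r => alt r lam.index := by
    funext lam
    simp [alt_eq_mul, hDet_index]
  rw [heq]
  exact hlin

theorem sum_alt (r k : ℕ) (f : Fin r → ℕ) :
    ∑ t ∈ (Finset.univ : Finset (Fin r)).powersetCard k,
      alt r (fun b => f b + if b ∈ t then 1 else 0) =
      MvPolynomial.esymm (Fin r) ℤ k * alt r f := by
  simp_rw [alt, Matrix.det_apply, Matrix.of_apply]
  rw [Finset.sum_comm, Finset.mul_sum]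
  refine Finset.sum_congr rfl fun s _ => ?_
  rw [← Finset.smul_sum, mul_smul_comm]
  congr 1
  simp_rw [pow_add, Finset.prod_mul_distrib]
  rw [← Finset.mul_sum, mul_comm]
  congr 1
  rw [← MvPolynomial.rename_esymm (Fin r) ℤ k s, MvPolynomial.esymm, map_sum]
  refine Finset.sum_congr rfl fun t _ => ?_
  rw [map_prod]
  simp [pow_ite, Finset.prod_ite_mem]

theorem X_mul_hDet (r : ℕ) (j : Fin r) (f : Fin r → ℕ) :
    MvPolynomial.X j * hDet r f = ∑ t ∈ (Finset.univ : Finset (Fin r)).powersetCard ((j : ℕ) + 1),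
      hDet r (fun b => f b + if b ∈ t then 1 else 0) := by
  apply theta_injective r
  apply mul_left_cancel₀ (transMat_det_ne_zero r)
  have h1 := sum_alt r ((j : ℕ) + 1) f
  simp_rw [alt_eq_mul] at h1
  rw [map_sum, Finset.mul_sum, h1, map_mul, theta_X]
  ring

theorem hDet_mem_span (r : ℕ) (f : Fin r → ℕ) :
    hDet r f ∈ Submodule.span ℤ (Set.range fun lam : Ptn r => schurDet lam (h r)) := by
  by_cases hf : Function.Injective f
  · set s := Tuple.sort f with hs
    have hmono : StrictMono (f ∘ s) :=
      (Tuple.monotone_sort f).strictMono_of_injective (hf.comp s.injective)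
    obtain ⟨lam, hlam⟩ := exists_ptn hmono
    have h1 : schurDet lam (h r) = ((Equiv.Perm.sign s : ℤˣ) : B r) * hDet r f := by
      rw [← hDet_index, hlam, hDet, hDet, ← Matrix.det_permute']
      rfl
    have h2 : hDet r f = ((Equiv.Perm.sign s : ℤˣ) : ℤ) • schurDet lam (h r) := by
      rw [h1, zsmul_eq_mul, ← mul_assoc]
      rcases Int.units_eq_one_or (Equiv.Perm.sign s) with h | h <;> simp [h]
    rw [h2]
    exact Submodule.smul_mem _ _ (Submodule.subset_span ⟨lam, rfl⟩)
  · obtain ⟨i, j, hij, hne⟩ : ∃ i j, f i = f j ∧ i ≠ j := by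
      simpa [Function.Injective] using hf
    have : hDet r f = 0 := Matrix.det_zero_of_column_eq hne (by intro l; simp [hij])
    rw [this]
    exact Submodule.zero_mem _

theorem schurDet_span (r : ℕ) :
    ⊤ ≤ Submodule.span ℤ (Set.range fun lam : Ptn r => schurDet lam (h r)) := by
  set N := Submodule.span ℤ (Set.range fun lam : Ptn r => schurDet lam (h r)) with hN
  have hone : (1 : B r) ∈ N := by
    have h1 : hDet r (fun b => (b : ℕ)) = 1 := by
      rw [hDet, Matrix.det_of_isUpperTriangular]
      · simp [h_zero]
      · intro i j hij
        have hij' : (j : ℕ) < i := hij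
        exact h_neg r (by omega)
    rw [← h1]
    exact hDet_mem_span r _
  intro p _
  induction p using MvPolynomial.induction_on with
  | C a =>
    have : (MvPolynomial.C a : B r) = a • 1 := by
      rw [MvPolynomial.smul_eq_C_mul, mul_one]
    rw [this]
    exact N.smul_mem _ hone
  | add p q hp hq => exact N.add_mem (hp trivial) (hq trivial)
  | mul_X p j hp =>
    have hp' := hp trivial
    rw [hN] at hp'
    induction hp' using Submodule.span_induction with
    | mem x hx =>
      obtain ⟨lam, rfl⟩ := hx
      simp only
      rw [mul_comm, ← hDet_index, X_mul_hDet]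
      exact N.sum_mem fun t _ => hDet_mem_span r _
    | zero => simp
    | add x y _ _ hx hy =>
      rw [add_mul]
      exact N.add_mem (hx (fun _ => by assumption) trivial) (hy (fun _ => by assumption) trivial)
    | smul a x _ hx =>
      rw [smul_mul_assoc]
      exact N.smul_mem _ (hx (fun _ => by assumption) trivial)

/-- The `ℤ`-basis `(Δ_λ(H_r))` of `B_r`. -/
def schurBasis (r : ℕ) : Module.Basis (Ptn r) ℤ (B r) :=
  Module.Basis.mk (schurDet_linearIndependent r) (schurDet_span r)

theorem schurBasis_apply (r : ℕ) (lam : Ptn r) : schurBasis r lam = schurDet lam (h r) := by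
  simp [schurBasis]

/-- The free abelian group `M₀` on `b₀, b₁, …`. -/
abbrev M0 : Type := ℕ →₀ ℤ

/-- The basis element `b_i`, with `b_i = 0` for `i < 0`. -/
def b (i : ℤ) : M0 := if 0 ≤ i then Finsupp.single i.toNat 1 else 0

/-- `[b]^r_λ = b_{λ_r} ∧ b_{1 + λ_{r-1}} ∧ ⋯ ∧ b_{r - 1 + λ₁}`. -/
def bWedge {r : ℕ} (lam : Ptn r) : ⋀[ℤ]^r M0 :=
  exteriorPower.ιMulti ℤ r fun k : Fin r => b (lam.index k)

/-- The `ℤ`-basis `([b]^r_λ)` of `⋀^r M₀`. -/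
def wedgeBasis (r : ℕ) : Module.Basis (Ptn r) ℤ (⋀[ℤ]^r M0) :=
  (Module.Basis.exteriorPower r (Finsupp.basisSingleOne : Module.Basis ℕ ℤ M0)).reindex
    ((ptnEquiv r).trans Set.powersetCard.ofFinEmbEquiv).symm

theorem wedgeBasis_apply (r : ℕ) (lam : Ptn r) : wedgeBasis r lam = bWedge lam := by
  rw [wedgeBasis, Module.Basis.reindex_apply, exteriorPower.basis_apply,
    exteriorPower.ιMulti_family, bWedge]
  congr 1
  funext k
  simp only [Function.comp_apply, Equiv.symm_symm, Equiv.trans_apply, Equiv.symm_apply_apply,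
    Finsupp.coe_basisSingleOne, b, Int.natCast_nonneg, if_true, Int.toNat_natCast]
  rfl

/-- The isomorphism `φ_r : B_r → ⋀^r M₀` of abelian groups, `Δ_λ(H_r) ↦ [b]^r_λ`. -/
def phi (r : ℕ) : B r ≃ₗ[ℤ] ⋀[ℤ]^r M0 :=
  (schurBasis r).equiv (wedgeBasis r) (Equiv.refl _)

theorem phi_schurDet {r : ℕ} (lam : Ptn r) : phi r (schurDet lam (h r)) = bWedge lam := by
  rw [← schurBasis_apply, phi, Module.Basis.equiv_apply, Equiv.refl_apply, wedgeBasis_apply]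

/-! ### The Grassmann cone and the Schubert derivations -/

/-- The Grassmann cone: the image of `(m₁, …, m_r) ↦ m₁ ∧ ⋯ ∧ m_r`. -/
def grassmannCone (r : ℕ) : Set (⋀[ℤ]^r M0) :=
  Set.range fun m : Fin r → M0 => exteriorPower.ιMulti ℤ r m

/-- The exterior algebra `⋀ M₀`. -/
abbrev ExtM0 : Type := ExteriorAlgebra ℤ M0

/-- The polynomials over the exterior algebra all of whose coefficients lie in a submodule. -/
def CoeffsIn (N : Submodule ℤ ExtM0) (P : Polynomial ExtM0) : Prop := ∀ i, P.coeff i ∈ N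

theorem CoeffsIn.mul {N N' : Submodule ℤ ExtM0} {P Q : Polynomial ExtM0} (hP : CoeffsIn N P)
    (hQ : CoeffsIn N' Q) : CoeffsIn (N * N') (P * Q) := by
  intro n
  rw [Polynomial.coeff_mul]
  exact Submodule.sum_mem _ fun x _ => Submodule.mul_mem_mul (hP _) (hQ _)

theorem CoeffsIn.sq_eq_zero {P : Polynomial ExtM0}
    (hP : CoeffsIn (LinearMap.range (ExteriorAlgebra.ι ℤ (M := M0))) P) : P * P = 0 := by
  ext1 n
  rw [Polynomial.coeff_mul, Polynomial.coeff_zero]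
  refine Finset.sum_involution (fun x _ => x.swap) ?_ ?_ ?_ ?_
  · intro x _
    obtain ⟨u, hu⟩ := hP x.1
    obtain ⟨v, hv⟩ := hP x.2
    simp only [Prod.fst_swap, Prod.snd_swap]
    rw [← hu, ← hv]
    exact ExteriorAlgebra.ι_add_mul_swap u v
  · rintro ⟨i, j⟩ _ hne heq
    simp only [Prod.swap_prod_mk, Prod.mk.injEq] at heq
    obtain ⟨u, hu⟩ := hP i
    apply hne
    simp only [heq.1]
    rw [← hu]
    exact ExteriorAlgebra.ι_sq_zero u
  · intro x hx
    simpa [add_comm] using hx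
  · intro x _
    simp

/-- A family `d_j = ∑ᵢ d_{j,i} z^{-i}` of values on the basis elements `b_j`, with `d_{j,i} ∈ M₀`,
extends to a unique algebra homomorphism `⋀ M₀ → (⋀ M₀)[z^{-1}]`. The polynomial variable is
`z^{-1}`. -/
def hsDerivation (d : ℕ → Polynomial ExtM0)
    (hd : ∀ j, CoeffsIn (LinearMap.range (ExteriorAlgebra.ι ℤ (M := M0))) (d j)) :
    ExtM0 →ₐ[ℤ] Polynomial ExtM0 :=
  ExteriorAlgebra.lift ℤ ⟨Finsupp.linearCombination ℤ d, fun m => by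
    apply CoeffsIn.sq_eq_zero
    intro i
    rw [Finsupp.linearCombination_apply, Finsupp.sum, Polynomial.finsetSum_coeff]
    refine Submodule.sum_mem _ fun j _ => ?_
    rw [Polynomial.coeff_smul]
    exact Submodule.smul_mem _ _ (hd j i)⟩

theorem hsDerivation_b (d : ℕ → Polynomial ExtM0)
    (hd : ∀ j, CoeffsIn (LinearMap.range (ExteriorAlgebra.ι ℤ (M := M0))) (d j)) (j : ℕ) :
    hsDerivation d hd (ExteriorAlgebra.ι ℤ (b j)) = d j := by
  simp [hsDerivation, b]

theorem hsDerivation_coeff_mem (d : ℕ → Polynomial ExtM0)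
    (hd : ∀ j, CoeffsIn (LinearMap.range (ExteriorAlgebra.ι ℤ (M := M0))) (d j)) (r : ℕ)
    {x : ExtM0} (hx : x ∈ ⋀[ℤ]^r M0) : CoeffsIn (⋀[ℤ]^r M0) (hsDerivation d hd x) := by
  have h1 : ∀ m : M0, CoeffsIn (LinearMap.range (ExteriorAlgebra.ι ℤ (M := M0)))
      (hsDerivation d hd (ExteriorAlgebra.ι ℤ m)) := by
    intro m i
    rw [hsDerivation, ExteriorAlgebra.lift_ι_apply, Finsupp.linearCombination_apply, Finsupp.sum,
      Polynomial.finsetSum_coeff]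
    refine Submodule.sum_mem _ fun j _ => ?_
    rw [Polynomial.coeff_smul]
    exact Submodule.smul_mem _ _ (hd j i)
  induction hx using Submodule.pow_induction_on_left' with
  | algebraMap a =>
    intro i
    rw [AlgHom.commutes, Polynomial.algebraMap_apply, Polynomial.coeff_C]
    split
    · rw [ExteriorAlgebra.exteriorPower, pow_zero]
      exact Submodule.algebraMap_mem a
    · exact Submodule.zero_mem _
  | add x y i _ _ hx hy =>
    intro j
    rw [map_add, Polynomial.coeff_add]
    exact Submodule.add_mem _ (hx j) (hy j)
  | mem_mul m hm i x _ ih =>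
    obtain ⟨m, rfl⟩ := hm
    rw [map_mul, ExteriorAlgebra.exteriorPower, Nat.succ_eq_add_one, pow_succ']
    exact (h1 m).mul ih

/-- `σ_-(z) : ⋀ M₀ → (⋀ M₀)[z^{-1}]`, with `σ_-(z)(m ∧ m') = σ_-(z) m ∧ σ_-(z) m'` and
`σ_-(z) b_j = ∑ᵢ b_{j-i} z^{-i}`. -/
def sigmaMinus : ExtM0 →ₐ[ℤ] Polynomial ExtM0 :=
  hsDerivation
    (fun j => ∑ i ∈ Finset.range (j + 1), Polynomial.monomial i (ExteriorAlgebra.ι ℤ (b (j - i))))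
    (by
      intro j n
      rw [Polynomial.finsetSum_coeff]
      refine Submodule.sum_mem _ fun i _ => ?_
      rw [Polynomial.coeff_monomial]
      split
      · exact ⟨_, rfl⟩
      · exact Submodule.zero_mem _)

/-- `σ̄_-(z) : ⋀ M₀ → (⋀ M₀)[z^{-1}]`, the inverse of `σ_-(z)` (see
`sigmaMinus_mul_sigmaBarMinus`): the algebra homomorphism with
`σ̄_-(z) b_j = b_j - b_{j-1} z^{-1}`. -/
def sigmaBarMinus : ExtM0 →ₐ[ℤ] Polynomial ExtM0 :=
  hsDerivation
    (fun j => Polynomial.C (ExteriorAlgebra.ι ℤ (b j)) -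
      Polynomial.monomial 1 (ExteriorAlgebra.ι ℤ (b ((j : ℤ) - 1))))
    (by
      intro j n
      rw [Polynomial.coeff_sub, Polynomial.coeff_C, Polynomial.coeff_monomial]
      refine Submodule.sub_mem _ ?_ ?_ <;> split
      · exact ⟨_, rfl⟩
      · exact Submodule.zero_mem _
      · exact ⟨_, rfl⟩
      · exact Submodule.zero_mem _)

/-- `∑ᵢ D_i z^{-i}` as a formal power series, in the variable `z^{-1}`, of endomorphisms. -/
def toEndSeries (D : ExtM0 →ₐ[ℤ] Polynomial ExtM0) : PowerSeries (Module.End ℤ ExtM0) :=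
  PowerSeries.mk fun i => ((Polynomial.lcoeff ExtM0 i).restrictScalars ℤ).comp D.toLinearMap

/-- The `z^{-1}`-linear extension of an operator `D(z)` to `(⋀ M₀)[z^{-1}]`. -/
def extendHS (D : ExtM0 →ₐ[ℤ] Polynomial ExtM0) : Polynomial ExtM0 →+* Polynomial ExtM0 :=
  Polynomial.eval₂RingHom' (D : ExtM0 →+* Polynomial ExtM0) Polynomial.X
    fun _ => (Polynomial.commute_X _).symm

theorem extendHS_monomial (D : ExtM0 →ₐ[ℤ] Polynomial ExtM0) (k : ℕ) (a : ExtM0) :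
    extendHS D (Polynomial.monomial k a) = D a * Polynomial.X ^ k :=
  Polynomial.eval₂_monomial _ _

theorem toEndSeries_mul (D D' : ExtM0 →ₐ[ℤ] Polynomial ExtM0) (hDD : ∀ j : ℕ,
    extendHS D (D' (ExteriorAlgebra.ι ℤ (b j))) = Polynomial.C (ExteriorAlgebra.ι ℤ (b j))) :
    toEndSeries D * toEndSeries D' = 1 := by
  have h1 : (extendHS D).toIntAlgHom.comp D' = Polynomial.CAlgHom := by
    apply ExteriorAlgebra.hom_ext
    refine Finsupp.lhom_ext' fun j => LinearMap.ext_ring ?_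
    have h2 := hDD j
    simp only [b, Int.natCast_nonneg, if_true, Int.toNat_natCast] at h2
    exact h2
  ext1 n
  refine LinearMap.ext fun x => ?_
  rw [PowerSeries.coeff_mul, LinearMap.sum_apply]
  have h2 : extendHS D (D' x) = Polynomial.C x := congrArg (fun f : ExtM0 →ₐ[ℤ] Polynomial ExtM0 => f x) h1
  have h3 : ∀ P, (extendHS D P).coeff n = ∑ y ∈ Finset.HasAntidiagonal.antidiagonal n, (D (P.coeff y.2)).coeff y.1 := by
    intro P
    induction P using Polynomial.induction_on' with
    | add P Q hP hQ => simp [map_add, hP, hQ, Finset.sum_add_distrib]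
    | monomial k a =>
      rw [extendHS_monomial, Polynomial.coeff_mul_X_pow']
      simp_rw [Polynomial.coeff_monomial]
      split_ifs with hk
      · rw [Finset.sum_eq_single (n - k, k)]
        · simp
        · rintro ⟨i, j⟩ hij hne
          rw [Finset.HasAntidiagonal.mem_antidiagonal] at hij
          simp only at hij ⊢
          rw [if_neg]
          · simp
          · rintro rfl
            exact hne (by simp; omega)
        · intro hnot
          exact absurd (by simp; omega) hnot
      · symm
        apply Finset.sum_eq_zero
        rintro ⟨i, j⟩ hij
        rw [Finset.HasAntidiagonal.mem_antidiagonal] at hij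
        simp only at hij ⊢
        rw [if_neg (by omega)]
        simp
  have h4 := h3 (D' x)
  rw [h2, Polynomial.coeff_C] at h4
  simp only [toEndSeries, PowerSeries.coeff_mk, Module.End.mul_apply, PowerSeries.coeff_one]
  change ∑ y ∈ Finset.HasAntidiagonal.antidiagonal n, (D ((D' x).coeff y.2)).coeff y.1 = _
  rw [← h4]
  split_ifs <;> rfl

theorem sigmaMinus_b (j : ℕ) : sigmaMinus (ExteriorAlgebra.ι ℤ (b j)) =
    ∑ i ∈ Finset.range (j + 1), Polynomial.monomial i (ExteriorAlgebra.ι ℤ (b (j - i))) :=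
  hsDerivation_b _ _ _

theorem sigmaBarMinus_b (j : ℕ) : sigmaBarMinus (ExteriorAlgebra.ι ℤ (b j)) =
    Polynomial.C (ExteriorAlgebra.ι ℤ (b j)) -
      Polynomial.monomial 1 (ExteriorAlgebra.ι ℤ (b ((j : ℤ) - 1))) :=
  hsDerivation_b _ _ _

theorem sigmaMinus_b_zero : sigmaMinus (ExteriorAlgebra.ι ℤ (b 0)) =
    Polynomial.C (ExteriorAlgebra.ι ℤ (b 0)) := by
  simpa using sigmaMinus_b 0

theorem sigmaMinus_b_succ (j : ℕ) : sigmaMinus (ExteriorAlgebra.ι ℤ (b ((j : ℤ) + 1))) =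
    Polynomial.C (ExteriorAlgebra.ι ℤ (b ((j : ℤ) + 1))) +
      sigmaMinus (ExteriorAlgebra.ι ℤ (b j)) * Polynomial.X := by
  have h1 := sigmaMinus_b (j + 1)
  rw [Finset.sum_range_succ'] at h1
  push_cast at h1
  rw [h1, sigmaMinus_b, Finset.sum_mul, add_comm]
  congr 1
  refine Finset.sum_congr rfl fun i _ => ?_
  rw [Polynomial.monomial_mul_X]
  congr 3
  ring

theorem sigmaBarMinus_mul_sigmaMinus : toEndSeries sigmaBarMinus * toEndSeries sigmaMinus = 1 := by
  apply toEndSeries_mul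
  intro j
  have hC : ∀ x, extendHS sigmaBarMinus (Polynomial.C x) = sigmaBarMinus x := fun x => by
    simpa using extendHS_monomial sigmaBarMinus 0 x
  have hX : extendHS sigmaBarMinus Polynomial.X = Polynomial.X := by
    rw [← Polynomial.monomial_one_one_eq_X, extendHS_monomial, map_one, one_mul, pow_one]
    exact Polynomial.monomial_one_one_eq_X.symm
  induction j with
  | zero =>
    have h1 := sigmaBarMinus_b 0
    have h2 : b (-1) = 0 := by simp [b]
    simp only [Nat.cast_zero, zero_sub, h2, map_zero, sub_zero] at h1
    rw [Nat.cast_zero, sigmaMinus_b_zero, hC, h1]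
  | succ j ih =>
    have h1 := sigmaBarMinus_b (j + 1)
    push_cast at h1 ⊢
    rw [add_sub_cancel_right] at h1
    rw [sigmaMinus_b_succ, map_add, map_mul, ih, hC, hX, h1, Polynomial.C_mul_X_eq_monomial,
      sub_add_cancel]

theorem sigmaMinus_mul_sigmaBarMinus : toEndSeries sigmaMinus * toEndSeries sigmaBarMinus = 1 := by
  apply toEndSeries_mul
  intro j
  have hC : ∀ x, extendHS sigmaMinus (Polynomial.C x) = sigmaMinus x := fun x => by
    simpa using extendHS_monomial sigmaMinus 0 x
  rw [sigmaBarMinus_b, map_sub, extendHS_monomial, hC, pow_one]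
  rcases j with _ | j
  · have h2 : b (-1) = 0 := by simp [b]
    simp only [Nat.cast_zero, zero_sub, h2, map_zero, zero_mul, sub_zero]
    exact sigmaMinus_b_zero
  · push_cast
    rw [add_sub_cancel_right, sigmaMinus_b_succ, add_sub_cancel_right]

/-- An operator `D(z)` on `⋀ M₀` that preserves the degrees, regarded as a map `B_r → B_r[z^{-1}]`
through `φ_r`: its value at `p` is `φ_r^{-1}(D(z) φ_r(p))`. -/
def transport (r : ℕ) (D : ExtM0 →ₐ[ℤ] Polynomial ExtM0)
    (hD : ∀ x ∈ ⋀[ℤ]^r M0, CoeffsIn (⋀[ℤ]^r M0) (D x)) (p : B r) : Polynomial (B r) :=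
  ∑ i ∈ (D (phi r p : ExtM0)).support,
    Polynomial.monomial i ((phi r).symm ⟨(D (phi r p : ExtM0)).coeff i, hD _ (phi r p).2 i⟩)

/-- `σ_-(z) : B_r → B_r[z^{-1}]`. -/
def sigmaMinusB (r : ℕ) (p : B r) : Polynomial (B r) :=
  transport r sigmaMinus (fun _ hx => hsDerivation_coeff_mem _ _ r hx) p

/-- `σ̄_-(z) : B_r → B_r[z^{-1}]`. -/
def sigmaBarMinusB (r : ℕ) (p : B r) : Polynomial (B r) :=
  transport r sigmaBarMinus (fun _ hx => hsDerivation_coeff_mem _ _ r hx) p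

/-- The sequence `σ_-(z) H_r = (σ_-(z) h_n)`. For `r = 0`, where `h_n = 0` for `n > 0`, its `n`-th
term is by convention `z^{-n}` for `n ≥ 0`, and `0` for `n < 0`. -/
def sigmaMinusH (r : ℕ) (n : ℤ) : Polynomial (B r) :=
  if r = 0 then (if 0 ≤ n then Polynomial.X ^ n.toNat else 0) else sigmaMinusB r (h r n)

/-! ### Laurent series and residues -/

/-- The inclusion `R[z^{-1}] → R((z))`; the variable of the polynomials is `z^{-1}`. -/
def invLaurent {R : Type*} [CommRing R] : Polynomial R →+* LaurentSeries R :=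
  Polynomial.eval₂RingHom HahnSeries.C (HahnSeries.single (-1) 1)

/-- `f(z) ⊗ g(z) = ∑ (f_i ⊗ g_j) z^{i+j}`, a Laurent series over `R ⊗ S`. -/
def tensorSeries {R S : Type*} [CommRing R] [CommRing S] (f : LaurentSeries R)
    (g : LaurentSeries S) : LaurentSeries (R ⊗[ℤ] S) :=
  f.map (Algebra.TensorProduct.includeLeft : R →ₐ[ℤ] R ⊗[ℤ] S) *
    g.map (Algebra.TensorProduct.includeRight : S →ₐ[ℤ] R ⊗[ℤ] S)

/-- The residue: the coefficient of `z^{-1}`. -/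
def res {R : Type*} [CommRing R] (f : LaurentSeries R) : R := f.coeff (-1)

end

end SchubertCone

open SchubertCone

namespace SchubertCone

noncomputable section

/-! ### The Plücker quadric of the exterior algebra -/

/-! The residue is the Plücker form in disguise. Let P(x, y) = ∑ᵢ (bᵢ* ⌋ x) ⊗ (bᵢ ∧ y), the map
`plucker`. Two independent facts give the theorem.

First, m in degree r ≥ 1 is a pure wedge if and only if P(m, m) = 0 (`mem_grassmannCone_iff`). For a
pure wedge, P(m, m) is an alternating sum whose right factors vⱼ ∧ m vanish. Conversely, if m ≠ 0
and P(m, m) = 0, a coordinate functional on the left tensor factor produces u ≠ 0 in M₀ with u ∧ m =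
0. Over ℤ, u can be divided by its content to get w with f(w) = 1 for some linear form f; then m = w
∧ (f ⌋ m). As P commutes with contraction (`plucker_contract`), f ⌋ m again lies on the quadric, and
induction on the degree applies.

Second, φ_{r-1} ⊗ φ_{r+1} sends the (λ, μ) residue to -P([b]_λ, [b]_μ) (`phiTensor_res`). Row
operations on the Jacobi–Trudi determinants turn the left factor into a Laurent polynomial whose
terms are the signed minors with one index of λ deleted, the exponent of z recording that index
(`E_mul_schurDet_sigmaMinusH`). The coefficients of the right factor are, up to sign, the
determinants with an index i put in front of those of μ, that is, bᵢ ∧ [b]_μ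
(`coeff_invE_mul_sigmaBarMinusB`). Taking the residue matches the deleted index with the inserted
one. Bilinearity and injectivity of φ_{r-1} ⊗ φ_{r+1} conclude. -/

instance : Module.Free ℤ ExtM0 :=
  Module.Free.of_basis
    (Module.Basis.ExteriorAlgebra (Finsupp.basisSingleOne : Module.Basis ℕ ℤ M0))

/-- Contraction of the exterior algebra by a linear form. -/
def contract (d : Module.Dual ℤ M0) : ExtM0 →ₗ[ℤ] ExtM0 :=
  CliffordAlgebra.contractLeft (Q := (0 : QuadraticForm ℤ M0)) d

theorem contract_ι_mul (d : Module.Dual ℤ M0) (v : M0) (x : ExtM0) :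
    contract d (ExteriorAlgebra.ι ℤ v * x) = d v • x - ExteriorAlgebra.ι ℤ v * contract d x :=
  CliffordAlgebra.contractLeft_ι_mul _ _ _

theorem contract_algebraMap (d : Module.Dual ℤ M0) (c : ℤ) :
    contract d (algebraMap ℤ ExtM0 c) = 0 :=
  CliffordAlgebra.contractLeft_algebraMap _ _ _

theorem contract_one (d : Module.Dual ℤ M0) : contract d 1 = 0 :=
  CliffordAlgebra.contractLeft_one _ _

theorem contract_contract (d : Module.Dual ℤ M0) (x : ExtM0) : contract d (contract d x) = 0 :=
  CliffordAlgebra.contractLeft_contractLeft _ _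

theorem contract_comm (d d' : Module.Dual ℤ M0) (x : ExtM0) :
    contract d (contract d' x) = - contract d' (contract d x) :=
  CliffordAlgebra.contractLeft_comm _ _ _

/-- Each element involves only finitely many basis vectors: for v ∧ x, an index outside the support
of v and outside that of x contributes nothing. This makes the sum over all i in `plucker`
legitimate although M₀ has infinite rank. -/
theorem finite_support_contract (x : ExtM0) :
    (Function.support fun i : ℕ => contract (Finsupp.lapply i : M0 →ₗ[ℤ] ℤ) x).Finite := by
  induction x using CliffordAlgebra.left_induction with
  | algebraMap c =>
    convert Set.finite_empty (α := ℕ)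
    rw [Function.support_eq_empty_iff]
    exact funext fun i => contract_algebraMap _ c
  | add x y hx hy =>
    refine (hx.union hy).subset ?_
    simp_rw [map_add]
    exact Function.support_add _ _
  | ι_mul x v hx =>
    refine (v.support.finite_toSet.union hx).subset fun i hi => ?_
    by_contra hcon
    simp only [Set.mem_union, Finset.mem_coe, Finsupp.mem_support_iff, Function.mem_support,
      not_or, not_not] at hcon
    apply hi
    refine (contract_ι_mul _ _ _).trans ?_
    rw [hcon.2, Finsupp.lapply_apply, hcon.1, zero_smul, mul_zero, sub_zero]

/-- The family of all contractions `b_i^* ⌋ x` of an element of the exterior algebra. -/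
def contraction : ExtM0 →ₗ[ℤ] ℕ →₀ ExtM0 where
  toFun x := Finsupp.ofSupportFinite _ (finite_support_contract x)
  map_add' x y := by
    ext i
    exact map_add (contract (Finsupp.lapply i)) _ _
  map_smul' c x := by
    ext i
    exact map_smul (contract (Finsupp.lapply i)) _ _

theorem contraction_apply (x : ExtM0) (i : ℕ) :
    contraction x i = contract (Finsupp.lapply i : M0 →ₗ[ℤ] ℤ) x := rfl

theorem contraction_algebraMap (c : ℤ) : contraction (algebraMap ℤ ExtM0 c) = 0 := by
  ext i
  exact contract_algebraMap _ _

/-- The antiderivation rule bᵢ* ⌋ (v ∧ x) = vᵢ x - v ∧ (bᵢ* ⌋ x), summed against arbitrary weights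
K. Different K give the recursions for `plucker`, for contraction by a general form, and for Euler's
identity. -/
theorem lsum_contraction_ι_mul {N : Type*} [AddCommGroup N] (K : ℕ → ExtM0 →ₗ[ℤ] N) (v : M0)
    (x : ExtM0) : Finsupp.lsum ℤ K (contraction (ExteriorAlgebra.ι ℤ v * x)) =
      (v.sum fun i c => c • K i x) -
        Finsupp.lsum ℤ (fun i => (K i).comp (LinearMap.mulLeft ℤ (ExteriorAlgebra.ι ℤ v)))
          (contraction x) := by
  have h1 : contraction (ExteriorAlgebra.ι ℤ v * x) =
      Finsupp.mapRange.linearMap (LinearMap.toSpanSingleton ℤ ExtM0 x) v -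
        Finsupp.mapRange.linearMap (LinearMap.mulLeft ℤ (ExteriorAlgebra.ι ℤ v))
          (contraction x) := by
    ext i
    simp only [Finsupp.sub_apply, Finsupp.mapRange.linearMap_apply, Finsupp.mapRange_apply,
      contraction_apply, LinearMap.toSpanSingleton_apply, LinearMap.mulLeft_apply]
    exact contract_ι_mul _ _ _
  rw [h1, map_sub, Finsupp.lsum_apply, Finsupp.lsum_apply, Finsupp.mapRange.linearMap_apply,
    Finsupp.mapRange.linearMap_apply, Finsupp.sum_mapRange_index (by simp),
    Finsupp.sum_mapRange_index (by simp)]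
  simp only [LinearMap.toSpanSingleton_apply, map_smul]
  rfl

/-- The bilinear map `(x, y) ↦ ∑ᵢ (b_i^* ⌋ x) ⊗ (b_i ∧ y)`. -/
def plucker : ExtM0 →ₗ[ℤ] ExtM0 →ₗ[ℤ] ExtM0 ⊗[ℤ] ExtM0 :=
  LinearMap.mk₂ ℤ
    (fun x y => Finsupp.lsum ℤ (fun i => (TensorProduct.mk ℤ ExtM0 ExtM0).flip
      (ExteriorAlgebra.ι ℤ (Finsupp.single i 1) * y)) (contraction x))
    (fun x x' y => by rw [map_add, map_add])
    (fun c x y => by rw [map_smul, map_smul])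
    (fun x y y' => by
      simp only [Finsupp.lsum_apply, Finsupp.sum, ← Finset.sum_add_distrib]
      exact Finset.sum_congr rfl fun i _ => by rw [mul_add, map_add, LinearMap.add_apply])
    (fun c x y => by
      simp only [Finsupp.lsum_apply, Finsupp.sum, Finset.smul_sum]
      exact Finset.sum_congr rfl fun i _ => by rw [mul_smul_comm, map_smul, LinearMap.smul_apply])

theorem plucker_apply (x y : ExtM0) : plucker x y =
    (contraction x).sum fun i u => u ⊗ₜ (ExteriorAlgebra.ι ℤ (Finsupp.single i 1) * y) := rfl

theorem sum_smul_ι_single_mul (v : M0) (y : ExtM0) :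
    (v.sum fun i c => c • (ExteriorAlgebra.ι ℤ (Finsupp.single i 1) * y)) =
      ExteriorAlgebra.ι ℤ v * y := by
  conv_rhs => rw [← Finsupp.sum_single v]
  rw [Finsupp.sum, Finsupp.sum, map_sum, Finset.sum_mul]
  refine Finset.sum_congr rfl fun i _ => ?_
  rw [← smul_mul_assoc, ← map_smul, Finsupp.smul_single, smul_eq_mul, mul_one]

theorem plucker_ι_mul (v : M0) (x y : ExtM0) :
    plucker (ExteriorAlgebra.ι ℤ v * x) y = x ⊗ₜ (ExteriorAlgebra.ι ℤ v * y) -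
      (LinearMap.mulLeft ℤ (ExteriorAlgebra.ι ℤ v)).rTensor ExtM0 (plucker x y) := by
  refine (lsum_contraction_ι_mul _ v x).trans ?_
  congr 1
  · rw [← sum_smul_ι_single_mul v y, Finsupp.sum, Finsupp.sum, TensorProduct.tmul_sum]
    exact Finset.sum_congr rfl fun i _ => (TensorProduct.tmul_smul _ _ _).symm
  · rw [plucker_apply, Finsupp.lsum_apply, Finsupp.sum, Finsupp.sum, map_sum]
    rfl

/-- Iterates `plucker_ι_mul`. The basis has disappeared from the right side, which is also the shape
in which the residue will be recognised. -/
theorem plucker_ιMulti (n : ℕ) (v : Fin (n + 1) → M0) (y : ExtM0) :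
    plucker (ExteriorAlgebra.ιMulti ℤ (n + 1) v) y =
      ∑ j : Fin (n + 1), (-1 : ℤ) ^ (j : ℕ) •
        (ExteriorAlgebra.ιMulti ℤ n (v ∘ j.succAbove) ⊗ₜ[ℤ] (ExteriorAlgebra.ι ℤ (v j) * y)) := by
  induction n with
  | zero =>
    rw [ExteriorAlgebra.ιMulti_succ_apply, plucker_ι_mul, ExteriorAlgebra.ιMulti_zero_apply]
    have : contraction 1 = 0 := by simpa using contraction_algebraMap 1
    simp [plucker_apply, this]
  | succ n ih =>
    rw [ExteriorAlgebra.ιMulti_succ_apply, plucker_ι_mul, ih, Fin.sum_univ_succ (n := n + 1), sub_eq_add_neg,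
      map_sum, ← Finset.sum_neg_distrib]
    congr 1
    · simp [Matrix.vecTail, Function.comp_def]
    · refine Finset.sum_congr rfl fun j _ => ?_
      rw [map_smul, LinearMap.rTensor_tmul, LinearMap.mulLeft_apply,
        ExteriorAlgebra.ιMulti_succ_apply, Fin.val_succ, pow_succ, mul_neg_one, neg_smul]
      simp only [Matrix.vecTail, Function.comp_def, Fin.succ_succAbove_zero,
        Fin.succ_succAbove_succ]

theorem plucker_ιMulti_self (n : ℕ) (v : Fin (n + 1) → M0) :
    plucker (ExteriorAlgebra.ιMulti ℤ (n + 1) v) (ExteriorAlgebra.ιMulti ℤ (n + 1) v) = 0 := by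
  rw [plucker_ιMulti]
  refine Finset.sum_eq_zero fun j _ => ?_
  -- The vector `v j` already occurs in the wedge that it multiplies.
  rw [ExteriorAlgebra.ιMulti_apply (v := v), ExteriorAlgebra.ι_mul_prod_list, TensorProduct.tmul_zero,
    smul_zero]

/-- Expresses d = ∑ d(bᵢ) bᵢ*. This sum may be infinite, but it is finite when applied to a given x.
-/
theorem contraction_sum_dual (d : Module.Dual ℤ M0) (x : ExtM0) :
    Finsupp.lsum ℤ (fun i => d (Finsupp.single i 1) • (LinearMap.id : ExtM0 →ₗ[ℤ] ExtM0)) (contraction x) =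
      contract d x := by
  induction x using CliffordAlgebra.left_induction with
  | algebraMap c =>
    refine (congrArg _ (contraction_algebraMap c)).trans ?_
    rw [map_zero]
    exact (contract_algebraMap d c).symm
  | add x y hx hy => rw [map_add, map_add, map_add, hx, hy]
  | ι_mul x v hx =>
    refine (lsum_contraction_ι_mul _ v x).trans ?_
    refine Eq.trans ?_ (contract_ι_mul _ _ _).symm
    rw [← hx]
    congr 1
    · conv_rhs => rw [← Finsupp.sum_single v]
      rw [Finsupp.sum, Finsupp.sum, map_sum, Finset.sum_smul]
      refine Finset.sum_congr rfl fun i _ => ?_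
      rw [LinearMap.smul_apply, smul_smul, LinearMap.id_apply]
      congr 1
      rw [← smul_eq_mul, ← map_smul, Finsupp.smul_single, smul_eq_mul, mul_one]
    · rw [Finsupp.lsum_apply, Finsupp.lsum_apply, Finsupp.sum, Finsupp.sum, Finset.mul_sum]
      refine Finset.sum_congr rfl fun i _ => ?_
      rw [LinearMap.comp_apply, LinearMap.smul_apply, LinearMap.smul_apply, LinearMap.id_apply,
        LinearMap.id_apply, mul_smul_comm, LinearMap.mulLeft_apply]

/-- Contractions anticommute, and d ⌋ (bᵢ ∧ y) = d(bᵢ) y - bᵢ ∧ (d ⌋ y). The two sides then differ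
only by (∑ᵢ d(bᵢ) d ⌋ (bᵢ* ⌋ x)) ⊗ y, whose left factor is d ⌋ (d ⌋ x) = 0. This drives the
induction on the degree. -/
theorem plucker_contract (d : Module.Dual ℤ M0) (x y : ExtM0) :
    plucker (contract d x)
      (contract d y) =
      TensorProduct.map (contract d)
        (contract d) (plucker x y) := by
  set D := contract d with hD
  have h1 : contraction (D x) = - Finsupp.mapRange.linearMap D (contraction x) := by
    ext i
    rw [Finsupp.neg_apply, Finsupp.mapRange.linearMap_apply, Finsupp.mapRange_apply,
      contraction_apply, contraction_apply, hD, contract_comm]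
  have h2 : Finsupp.lsum ℤ (fun i => d (Finsupp.single i 1) • (LinearMap.id : ExtM0 →ₗ[ℤ] ExtM0))
      (contraction (D x)) = 0 := by
    rw [contraction_sum_dual, hD, contract_contract]
  rw [h1] at h2
  have h3 : ∑ i ∈ (contraction x).support, d (Finsupp.single i 1) • D (contraction x i) = 0 := by
    rw [map_neg, neg_eq_zero, Finsupp.lsum_apply, Finsupp.mapRange.linearMap_apply,
      Finsupp.sum_mapRange_index (by simp)] at h2
    simpa [Finsupp.sum] using h2
  change Finsupp.lsum ℤ _ (contraction (D x)) = _
  rw [h1, map_neg, Finsupp.lsum_apply, Finsupp.mapRange.linearMap_apply,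
    Finsupp.sum_mapRange_index (by simp), plucker_apply, Finsupp.sum, Finsupp.sum, map_sum,
    ← Finset.sum_neg_distrib]
  have h4 : ∀ i ∈ (contraction x).support,
      TensorProduct.map D D (contraction x i ⊗ₜ (ExteriorAlgebra.ι ℤ (Finsupp.single i 1) * y)) =
      (d (Finsupp.single i 1) • D (contraction x i)) ⊗ₜ[ℤ] y -
        D (contraction x i) ⊗ₜ (ExteriorAlgebra.ι ℤ (Finsupp.single i 1) * D y) := by
    intro i _
    have : D (ExteriorAlgebra.ι ℤ (Finsupp.single i 1) * y) = d (Finsupp.single i 1) • y -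
        ExteriorAlgebra.ι ℤ (Finsupp.single i 1) * D y :=
      contract_ι_mul _ _ _
    rw [TensorProduct.map_tmul, this, TensorProduct.tmul_sub, TensorProduct.tmul_smul,
      TensorProduct.smul_tmul']
  rw [Finset.sum_congr rfl h4, Finset.sum_sub_distrib, ← TensorProduct.sum_tmul, h3,
    TensorProduct.zero_tmul, zero_sub, Finset.sum_neg_distrib]
  rfl

theorem contract_mem_exteriorPower (d : Module.Dual ℤ M0) (n : ℕ) {x : ExtM0}
    (hx : x ∈ ⋀[ℤ]^(n + 1) M0) :
    contract d x ∈ ⋀[ℤ]^n M0 := by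
  rw [← ExteriorAlgebra.ιMulti_span_fixedDegree] at hx
  induction hx using Submodule.span_induction with
  | zero => rw [map_zero]; exact Submodule.zero_mem _
  | add x y _ _ hx hy => rw [map_add]; exact Submodule.add_mem _ hx hy
  | smul c x _ hx => rw [map_smul]; exact Submodule.smul_mem _ _ hx
  | mem x hx =>
    obtain ⟨v, rfl⟩ := hx
    induction n with
    | zero =>
      have h1 : contract d
          (ExteriorAlgebra.ι ℤ (v 0) * 1) = d (v 0) • 1 - ExteriorAlgebra.ι ℤ (v 0) *
            contract d 1 :=
        contract_ι_mul _ _ _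
      rw [contract_one, mul_zero, sub_zero] at h1
      rw [ExteriorAlgebra.ιMulti_succ_apply, ExteriorAlgebra.ιMulti_zero_apply, h1]
      refine Submodule.smul_mem _ _ ?_
      rw [← ExteriorAlgebra.ιMulti_zero_apply (R := ℤ) (fun i : Fin 0 => (0 : M0))]
      exact ExteriorAlgebra.ιMulti_range ℤ 0 ⟨_, rfl⟩
    | succ n ih =>
      have h1 : contract d
          (ExteriorAlgebra.ιMulti ℤ (n + 1 + 1) v) =
          d (v 0) • ExteriorAlgebra.ιMulti ℤ (n + 1) (Matrix.vecTail v) -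
            ExteriorAlgebra.ι ℤ (v 0) * contract d
              (ExteriorAlgebra.ιMulti ℤ (n + 1) (Matrix.vecTail v)) := by
        rw [ExteriorAlgebra.ιMulti_succ_apply]
        exact contract_ι_mul _ _ _
      rw [h1]
      refine Submodule.sub_mem _ (Submodule.smul_mem _ _
        (ExteriorAlgebra.ιMulti_range ℤ (n + 1) ⟨_, rfl⟩)) ?_
      rw [ExteriorAlgebra.exteriorPower, pow_succ']
      exact Submodule.mul_mem_mul ⟨_, rfl⟩ (ih _)

/-! ### Points of the quadric are multiples of pure wedges. -/

/-- Euler's identity `∑ᵢ b_i ∧ (b_i^* ⌋ x) = n x` in degree `n`. -/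
theorem euler_contraction (n : ℕ) {x : ExtM0} (hx : x ∈ ⋀[ℤ]^n M0) :
    Finsupp.lsum ℤ (fun i => LinearMap.mulLeft ℤ (ExteriorAlgebra.ι ℤ (Finsupp.single i 1)))
      (contraction x) = (n : ℤ) • x := by
  rw [← ExteriorAlgebra.ιMulti_span_fixedDegree] at hx
  induction hx using Submodule.span_induction with
  | zero => simp
  | add x y _ _ hx hy => rw [map_add, map_add, hx, hy, smul_add]
  | smul c x _ hx => rw [map_smul, map_smul, hx, smul_comm]
  | mem x hx =>
    obtain ⟨v, rfl⟩ := hx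
    induction n with
    | zero =>
      have : contraction 1 = 0 := by simpa using contraction_algebraMap 1
      simp [this]
    | succ n ih =>
      rw [ExteriorAlgebra.ιMulti_succ_apply, lsum_contraction_ι_mul]
      have h1 := ih (Matrix.vecTail v)
      set x := ExteriorAlgebra.ιMulti ℤ n (Matrix.vecTail v)
      have h2 : Finsupp.lsum ℤ (fun i =>
          (LinearMap.mulLeft ℤ (ExteriorAlgebra.ι ℤ (Finsupp.single i 1))).comp
            (LinearMap.mulLeft ℤ (ExteriorAlgebra.ι ℤ (v 0)))) (contraction x) =
          -(ExteriorAlgebra.ι ℤ (v 0) * ((n : ℤ) • x)) := by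
        rw [← h1, Finsupp.lsum_apply, Finsupp.lsum_apply, Finsupp.sum, Finsupp.sum,
          Finset.mul_sum, ← Finset.sum_neg_distrib]
        refine Finset.sum_congr rfl fun i _ => ?_
        rw [LinearMap.comp_apply, LinearMap.mulLeft_apply, LinearMap.mulLeft_apply,
          LinearMap.mulLeft_apply, ← mul_assoc, ← mul_assoc, ← neg_mul]
        congr 1
        exact eq_neg_of_add_eq_zero_left (ExteriorAlgebra.ι_add_mul_swap _ _)
      rw [h2, sub_neg_eq_add]
      simp only [LinearMap.mulLeft_apply]
      rw [sum_smul_ι_single_mul, mul_smul_comm, Nat.cast_succ, add_smul, one_smul, add_comm]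

/-- By Euler's identity and torsion-freeness some bᵢ* ⌋ x is nonzero, so some coordinate functional
α does not kill it. Take u = ∑ᵢ α(bᵢ* ⌋ x) bᵢ; applying α to the left factor of the Plücker relation
gives u ∧ x = 0. -/
theorem exists_ι_mul_eq_zero (n : ℕ) {x : ExtM0} (hx : x ∈ ⋀[ℤ]^(n + 1) M0) (hx0 : x ≠ 0)
    (hp : plucker x x = 0) : ∃ u : M0, u ≠ 0 ∧ ExteriorAlgebra.ι ℤ u * x = 0 := by
  have h1 : contraction x ≠ 0 := by
    intro h0
    have h2 := euler_contraction (n + 1) hx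
    rw [h0, map_zero] at h2
    exact (smul_ne_zero (by exact_mod_cast n.succ_ne_zero) hx0) h2.symm
  obtain ⟨i, hi⟩ := Finsupp.ne_iff.mp h1
  obtain ⟨t, ht⟩ := Finsupp.ne_iff.mp
    ((Module.Free.chooseBasis ℤ ExtM0).repr.map_ne_zero_iff.mpr hi)
  set α : ExtM0 →ₗ[ℤ] ℤ := (Module.Free.chooseBasis ℤ ExtM0).coord t with hα
  refine ⟨Finsupp.mapRange.linearMap α (contraction x), ?_, ?_⟩
  · intro h0
    apply ht
    have := DFunLike.congr_fun h0 i
    simpa [hα] using this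
  · have h2 := congrArg (TensorProduct.lift ((LinearMap.lsmul ℤ ExtM0).comp α)) hp
    rw [plucker_apply, map_zero, Finsupp.sum, map_sum] at h2
    rw [← sum_smul_ι_single_mul, Finsupp.mapRange.linearMap_apply,
      Finsupp.sum_mapRange_index (by simp)]
    simpa [Finsupp.sum] using h2

/-- The values at u of all linear forms are an ideal gℤ. The generator g is attained by some f and
divides every coordinate of u, so w = u / g works. This replaces the division that would be
available over a field. -/
theorem exists_primitive {u : M0} (hu : u ≠ 0) :
    ∃ (w : M0) (f : Module.Dual ℤ M0) (g : ℤ), g ≠ 0 ∧ u = g • w ∧ f w = 1 := by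
  obtain ⟨g, hg⟩ := (IsPrincipalIdealRing.principal
    (LinearMap.range (LinearMap.applyₗ (R := ℤ) (M₂ := ℤ) u))).principal
  obtain ⟨f, hf⟩ : g ∈ LinearMap.range (LinearMap.applyₗ (R := ℤ) (M₂ := ℤ) u) := by
    rw [hg]; exact Submodule.mem_span_singleton_self g
  have hdvd : ∀ i, g ∣ u i := fun i => by
    have : u i ∈ LinearMap.range (LinearMap.applyₗ (R := ℤ) (M₂ := ℤ) u) :=
      ⟨Finsupp.lapply i, rfl⟩
    rw [hg] at this
    exact Ideal.mem_span_singleton.mp this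
  have hg0 : g ≠ 0 := by
    rintro rfl
    exact hu (Finsupp.ext fun i => by simpa using hdvd i)
  have hw : u = g • u.mapRange (· / g) (Int.zero_ediv g) := by
    ext i
    simp [Int.mul_ediv_cancel' (hdvd i)]
  refine ⟨_, f, g, hg0, hw, ?_⟩
  have h1 : f u = g := hf
  rw [hw, map_smul, smul_eq_mul] at h1
  exact mul_left_cancel₀ hg0 (h1.trans (mul_one g).symm)

/-- An element of the Plücker quadric over `ℤ` is an integer multiple of a pure wedge. -/
theorem exists_smul_ιMulti_of_plucker_eq_zero (n : ℕ) {x : ExtM0} (hx : x ∈ ⋀[ℤ]^n M0)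
    (hp : plucker x x = 0) :
    ∃ (c : ℤ) (v : Fin n → M0), x = c • ExteriorAlgebra.ιMulti ℤ n v := by
  induction n generalizing x with
  | zero =>
    rw [ExteriorAlgebra.exteriorPower, pow_zero] at hx
    obtain ⟨c, rfl⟩ := Submodule.mem_one.mp hx
    exact ⟨c, 0, by rw [ExteriorAlgebra.ιMulti_zero_apply, Algebra.algebraMap_eq_smul_one]⟩
  | succ n ih =>
    by_cases hx0 : x = 0
    · exact ⟨0, 0, by rw [hx0, zero_smul]⟩
    obtain ⟨u, hu0, hu⟩ := exists_ι_mul_eq_zero n hx hx0 hp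
    obtain ⟨w, f, g, hg0, rfl, hfw⟩ := exists_primitive hu0
    have hw : ExteriorAlgebra.ι ℤ w * x = 0 := by
      rw [map_smul, smul_mul_assoc] at hu
      exact (smul_eq_zero.mp hu).resolve_left hg0
    -- Contract w ∧ x = 0 by f and use f(w) = 1.
    have h1 : x = ExteriorAlgebra.ι ℤ w * contract f x := by
      have h2 : contract f (ExteriorAlgebra.ι ℤ w * x) =
          f w • x - ExteriorAlgebra.ι ℤ w * contract f x :=
        contract_ι_mul _ _ _
      rw [hw, map_zero, hfw, one_smul] at h2
      exact (sub_eq_zero.mp h2.symm)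
    obtain ⟨c, v, hv⟩ := ih (contract_mem_exteriorPower f n hx)
      (by rw [plucker_contract, hp, map_zero])
    refine ⟨c, Matrix.vecCons w v, ?_⟩
    rw [h1, hv, ExteriorAlgebra.ιMulti_succ_apply, mul_smul_comm]
    simp

theorem mem_grassmannCone_iff (n : ℕ) (m : ⋀[ℤ]^(n + 1) M0) :
    m ∈ grassmannCone (n + 1) ↔ plucker (m : ExtM0) (m : ExtM0) = 0 := by
  constructor
  · rintro ⟨v, rfl⟩
    exact plucker_ιMulti_self n v
  · intro hp
    obtain ⟨c, v, hv⟩ := exists_smul_ιMulti_of_plucker_eq_zero (n + 1) m.2 hp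
    -- The positive degree provides a first vector to absorb the scalar.
    refine ⟨Function.update v 0 (c • v 0), Subtype.ext ?_⟩
    rw [hv, exteriorPower.ιMulti_apply_coe, AlternatingMap.map_update_smul,
      Function.update_eq_self]

/-! ### The isomorphism `φ` and the Schubert derivations as determinants -/

/-- The linear map `b_j ↦ (h_{j - l})_l`. -/
def hColumn (s : ℕ) : M0 →ₗ[ℤ] Fin s → B s :=
  Finsupp.linearCombination ℤ fun (j : ℕ) (l : Fin s) => h s ((j : ℤ) - (l : ℤ))

theorem hColumn_b (s : ℕ) (j : ℤ) (l : Fin s) : hColumn s (b j) l = h s (j - (l : ℤ)) := by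
  by_cases hj : 0 ≤ j
  · simp [hColumn, b, hj]
  · rw [b, if_neg hj, map_zero, Pi.zero_apply, h_neg s (by omega)]

/-- The alternating map `(m₁, …, m_s) ↦ det (hColumn m_k)`. -/
def hAlternating (s : ℕ) : M0 [⋀^Fin s]→ₗ[ℤ] B s :=
  { ((Matrix.detRowAlternating (n := Fin s) (R := B s)).toMultilinearMap.restrictScalars
      ℤ).compLinearMap fun _ => hColumn s with
    map_eq_zero_of_eq' := fun v i j hij hne =>
      Matrix.detRowAlternating.map_eq_zero_of_eq (fun k => hColumn s (v k)) (by rw [hij]) hne }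

theorem hAlternating_apply (s : ℕ) (m : Fin s → M0) :
    hAlternating s m = Matrix.det (Matrix.of fun k l : Fin s => hColumn s (m k) l) := rfl

theorem hAlternating_b (s : ℕ) (f : Fin s → ℕ) :
    hAlternating s (fun k => b (f k)) = hDet s f := by
  rw [hAlternating_apply, hDet, ← Matrix.det_transpose]
  congr 1
  ext1 l k
  exact hColumn_b s _ _

/-- The extension by zero of `φ_s^{-1}` to the exterior algebra. -/
def phiInv (s : ℕ) : ExtM0 →ₗ[ℤ] B s :=
  ExteriorAlgebra.liftAlternating (Pi.single s (hAlternating s))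

theorem phiInv_ιMulti (s : ℕ) (m : Fin s → M0) :
    phiInv s (ExteriorAlgebra.ιMulti ℤ s m) = hAlternating s m := by
  rw [phiInv, ExteriorAlgebra.liftAlternating_apply_ιMulti, Pi.single_eq_same]

theorem phi_symm_apply (s : ℕ) (x : ⋀[ℤ]^s M0) : (phi s).symm x = phiInv s x := by
  have h1 : (phi s).symm.toLinearMap = (phiInv s).comp (Submodule.subtype _) := by
    refine (wedgeBasis s).ext fun lam => ?_
    rw [wedgeBasis_apply, LinearEquiv.coe_coe, ← phi_schurDet, LinearEquiv.symm_apply_apply,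
      phi_schurDet, ← hDet_index, ← hAlternating_b, ← phiInv_ιMulti]
    rfl
  exact LinearMap.congr_fun h1 x

/-- Both sides are alternating in the indices, so f need not be increasing: later an index can be
put in front without sorting. -/
theorem phi_hDet (s : ℕ) (f : Fin s → ℕ) :
    phi s (hDet s f) = exteriorPower.ιMulti ℤ s fun k => b (f k) := by
  rw [← LinearEquiv.eq_symm_apply, phi_symm_apply, exteriorPower.ιMulti_apply_coe, phiInv_ιMulti,
    hAlternating_b]

/-! ### Multiplicative operators on the exterior algebra act columnwise on determinants. -/

/-- The inclusion of `M₀[z^{-1}]` into the polynomials over the exterior algebra. -/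
def ιPoly : (ℕ →₀ M0) →ₗ[ℤ] Polynomial ExtM0 :=
  Finsupp.lsum ℤ fun n =>
    ((Polynomial.monomial n : ExtM0 →ₗ[ExtM0] Polynomial ExtM0).restrictScalars ℤ).comp
      (ExteriorAlgebra.ι ℤ)

/-- The `z^{-1}`-linear extension of `hColumn`. -/
def hColumnPoly (s : ℕ) : (ℕ →₀ M0) →ₗ[ℤ] Fin s → Polynomial (B s) :=
  Finsupp.lsum ℤ fun n => LinearMap.pi fun l =>
    ((Polynomial.monomial n : B s →ₗ[B s] Polynomial (B s)).restrictScalars ℤ).comp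
      ((LinearMap.proj l).comp (hColumn s))

theorem ιPoly_single (n : ℕ) (m : M0) :
    ιPoly (Finsupp.single n m) = Polynomial.monomial n (ExteriorAlgebra.ι ℤ m) := by
  simp [ιPoly]

theorem hColumnPoly_single (s n : ℕ) (m : M0) (l : Fin s) :
    hColumnPoly s (Finsupp.single n m) l = Polynomial.monomial n (hColumn s m l) := by
  simp [hColumnPoly]

theorem list_prod_monomial {A : Type*} [Semiring A] {s : ℕ} (n : Fin s → ℕ) (a : Fin s → A) :
    (List.ofFn fun k => Polynomial.monomial (n k) (a k)).prod =
      Polynomial.monomial (∑ k, n k) (List.ofFn a).prod := by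
  induction s with
  | zero => simp
  | succ s ih =>
    rw [List.ofFn_succ, List.prod_cons, ih, Polynomial.monomial_mul_monomial, Fin.sum_univ_succ,
      List.ofFn_succ, List.prod_cons]

theorem det_monomial {A : Type*} [CommRing A] {s : ℕ} (n : Fin s → ℕ)
    (a : Matrix (Fin s) (Fin s) A) :
    Matrix.det (Matrix.of fun k l => Polynomial.monomial (n k) (a k l)) =
      Polynomial.monomial (∑ k, n k) a.det := by
  simp_rw [← Polynomial.C_mul_X_pow_eq_monomial, mul_comm (Polynomial.C _)]
  have h1 := Matrix.det_mul_column (fun k => (Polynomial.X : Polynomial A) ^ n k)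
    (a.map Polynomial.C)
  rw [Finset.prod_pow_eq_pow_sum] at h1
  refine h1.trans ?_
  rw [RingHom.map_det]
  rfl

theorem phiInv_coeff_prod (s : ℕ) (Q : Fin s → ℕ →₀ M0) (n : ℕ) :
    phiInv s ((List.ofFn fun k => ιPoly (Q k)).prod.coeff n) =
      (Matrix.det (Matrix.of fun k l : Fin s => hColumnPoly s (Q k) l)).coeff n := by
  let F₁ : MultilinearMap ℤ (fun _ : Fin s => ℕ →₀ M0) (B s) :=
    ((phiInv s).comp ((Polynomial.lcoeff ExtM0 n).restrictScalars ℤ)).compMultilinearMap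
      ((MultilinearMap.mkPiAlgebraFin ℤ s (Polynomial ExtM0)).compLinearMap fun _ => ιPoly)
  let F₂ : MultilinearMap ℤ (fun _ : Fin s => ℕ →₀ M0) (B s) :=
    ((Polynomial.lcoeff (B s) n).restrictScalars ℤ).compMultilinearMap
      (((Matrix.detRowAlternating (n := Fin s)
        (R := Polynomial (B s))).toMultilinearMap.restrictScalars ℤ).compLinearMap
          fun _ => hColumnPoly s)
  suffices hF : F₁ = F₂ by
    have h1 := MultilinearMap.congr_fun hF Q
    simp only [F₁, MultilinearMap.mkPiAlgebraFin_apply, MultilinearMap.compLinearMap_apply,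
      LinearMap.compMultilinearMap_apply] at h1
    exact h1
  -- By multilinearity each factor may be taken to be a single bⱼ z^{-n}; both products are then
  -- monomials of the same exponent, and the coefficients agree by `phiInv_ιMulti`.
  refine Module.Basis.ext_multilinear
    (fun _ => Finsupp.basis fun _ : ℕ => (Finsupp.basisSingleOne : Module.Basis ℕ ℤ M0))
    fun v => ?_
  change phiInv s ((MultilinearMap.mkPiAlgebraFin ℤ s (Polynomial ExtM0) fun k => ιPoly _).coeff n) =
    (Matrix.det (Matrix.of fun k l : Fin s => hColumnPoly s _ l)).coeff n
  simp only [Finsupp.coe_basis, Finsupp.coe_basisSingleOne, MultilinearMap.mkPiAlgebraFin_apply,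
    ιPoly_single, hColumnPoly_single]
  rw [list_prod_monomial, det_monomial (fun k => (v k).1)
    (fun k l => hColumn s (Finsupp.single (v k).2 1) l), Polynomial.coeff_monomial,
    Polynomial.coeff_monomial]
  split_ifs
  · rw [← ExteriorAlgebra.ιMulti_apply, phiInv_ιMulti]
    rfl
  · rw [map_zero]

theorem coeff_transport (s : ℕ) (D : ExtM0 →ₐ[ℤ] Polynomial ExtM0)
    (hD : ∀ x ∈ ⋀[ℤ]^s M0, CoeffsIn (⋀[ℤ]^s M0) (D x)) (p : B s) (n : ℕ) :
    (transport s D hD p).coeff n = phiInv s ((D (phi s p : ExtM0)).coeff n) := by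
  rw [transport, Polynomial.finsetSum_coeff]
  simp_rw [Polynomial.coeff_monomial, phi_symm_apply]
  rw [Finset.sum_ite_eq']
  split_ifs with hn
  · rfl
  · rw [Polynomial.notMem_support_iff.mp hn, map_zero]

/-- D is multiplicative, so it acts on each factor of a wedge separately; under φ_s^{-1} the factors
become the columns of a determinant. -/
theorem transport_hDet (s : ℕ) (D : ExtM0 →ₐ[ℤ] Polynomial ExtM0)
    (hD : ∀ x ∈ ⋀[ℤ]^s M0, CoeffsIn (⋀[ℤ]^s M0) (D x)) (c : ℕ → ℕ →₀ M0)
    (hc : ∀ j : ℕ, D (ExteriorAlgebra.ι ℤ (b j)) = ιPoly (c j)) (f : Fin s → ℕ) :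
    transport s D hD (hDet s f) =
      Matrix.det (Matrix.of fun l k : Fin s => hColumnPoly s (c (f k)) l) := by
  ext1 n
  rw [coeff_transport, phi_hDet, exteriorPower.ιMulti_apply_coe, ExteriorAlgebra.ιMulti_apply,
    map_list_prod, List.map_ofFn]
  simp only [Function.comp_def, hc]
  rw [phiInv_coeff_prod, ← Matrix.det_transpose]
  rfl

theorem sigmaBarMinusB_hDet (s : ℕ) (f : Fin s → ℕ) :
    sigmaBarMinusB s (hDet s f) = Matrix.det (Matrix.of fun l k : Fin s =>
      Polynomial.C (h s ((f k : ℤ) - (l : ℤ))) -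
        Polynomial.X * Polynomial.C (h s ((f k : ℤ) - 1 - (l : ℤ)))) := by
  refine (transport_hDet s _ _
    (fun j => Finsupp.single 0 (b j) - Finsupp.single 1 (b ((j : ℤ) - 1))) ?_ f).trans ?_
  · intro j
    rw [sigmaBarMinus_b, map_sub, ιPoly_single, ιPoly_single, Polynomial.monomial_zero_left]
  · congr 1
    ext1 l k
    rw [Matrix.of_apply, Matrix.of_apply, map_sub, Pi.sub_apply, hColumnPoly_single,
      hColumnPoly_single, hColumn_b, hColumn_b, Polynomial.monomial_zero_left,
      ← Polynomial.C_mul_X_eq_monomial, mul_comm]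

/-- `∑_{i ≥ 0} h_{n-i} z^{-i}`. -/
def hTail (s : ℕ) (n : ℤ) : Polynomial (B s) :=
  ∑ i ∈ Finset.range (n.toNat + 1), Polynomial.monomial i (h s (n - i))

theorem coeff_hTail (s : ℕ) (n : ℤ) (i : ℕ) : (hTail s n).coeff i = h s (n - i) := by
  rw [hTail, Polynomial.finsetSum_coeff]
  simp_rw [Polynomial.coeff_monomial]
  rw [Finset.sum_ite_eq']
  split_ifs with hi
  · rfl
  · rw [Finset.mem_range] at hi
    rw [h_neg s (by omega)]

theorem hTail_neg (s : ℕ) {n : ℤ} (hn : n < 0) : hTail s n = 0 := by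
  ext1 i
  rw [coeff_hTail, h_neg s (by omega), Polynomial.coeff_zero]

theorem hTail_zero (s : ℕ) : hTail s 0 = 1 := by
  simp [hTail, h_zero]

theorem sigmaMinusB_hDet (s : ℕ) (f : Fin s → ℕ) :
    sigmaMinusB s (hDet s f) =
      Matrix.det (Matrix.of fun l k : Fin s => hTail s ((f k : ℤ) - (l : ℤ))) := by
  refine (transport_hDet s _ _
    (fun j => ∑ i ∈ Finset.range (j + 1), Finsupp.single i (b ((j : ℤ) - i))) ?_ f).trans ?_
  · intro j
    rw [sigmaMinus_b, map_sum]
    simp_rw [ιPoly_single]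
  · congr 1
    ext1 l k
    ext1 i
    rw [Matrix.of_apply, Matrix.of_apply, map_sum, Finset.sum_apply, Polynomial.finsetSum_coeff,
      coeff_hTail]
    simp_rw [hColumnPoly_single, hColumn_b, Polynomial.coeff_monomial]
    rw [Finset.sum_ite_eq']
    split_ifs with hi
    · congr 1
      ring
    · rw [Finset.mem_range] at hi
      rw [h_neg s (by omega)]

/-- The matrix is upper triangular with diagonal 1, …, 1, G n. It presents a single h_n as a
full-size determinant, to which the column formula for σ₋ applies. -/
theorem det_of_hook {R : Type*} [CommRing R] (s n : ℕ) (G : ℤ → R) (hG0 : G 0 = 1)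
    (hG : ∀ m < 0, G m = 0) :
    Matrix.det (Matrix.of fun l k : Fin (s + 1) =>
      G (((Fin.snoc (α := fun _ => ℕ) (fun k : Fin s => (k : ℕ)) (s + n) k : ℕ) : ℤ) - (l : ℤ))) =
      G n := by
  rw [Matrix.det_of_isUpperTriangular]
  · rw [Fin.prod_univ_castSucc]
    simp [hG0]
  · intro l k hlk
    have hlk' : k < l := hlk
    induction k using Fin.lastCases with
    | last => exact absurd hlk' (not_lt.mpr (Fin.le_last l))
    | cast k =>
      have h1 : (k : ℕ) < l := hlk'
      rw [Matrix.of_apply, Fin.snoc_castSucc]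
      exact hG _ (by omega)

theorem invE_zero : invE 0 = 1 := by
  have h1 := E_mul_invE 0
  rwa [E, Finset.univ_eq_empty, Finset.sum_empty, add_zero, one_mul] at h1

theorem sigmaMinusH_eq_hTail (s : ℕ) (n : ℤ) : sigmaMinusH s n = hTail s n := by
  rcases lt_or_ge n 0 with hn | hn
  · rw [hTail_neg s hn, sigmaMinusH, h_neg s hn, if_neg (not_le.mpr hn)]
    split_ifs
    · rfl
    · ext1 i
      refine (coeff_transport _ _ _ _ _).trans ?_
      simp
  lift n to ℕ using hn
  rcases s with _ | s
  -- For s = 0 only h_0 = 1 survives, so the tail is z^{-n}, in agreement with the convention.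
  · ext1 i
    rw [sigmaMinusH, if_pos rfl, if_pos (by positivity), coeff_hTail, Int.toNat_natCast,
      Polynomial.coeff_X_pow]
    split_ifs with hi
    · rw [hi, sub_self, h_zero]
    · rw [h, invE_zero, PowerSeries.coeff_one]
      split_ifs
      · omega
      · rfl
      · rfl
  · have h1 := sigmaMinusB_hDet (s + 1) (Fin.snoc (α := fun _ => ℕ) (fun k : Fin s => (k : ℕ)) (s + n))
    rw [det_of_hook s n (hTail (s + 1)) (hTail_zero _) (fun _ => hTail_neg _), hDet,
      det_of_hook s n (h (s + 1)) (h_zero _) (fun _ => h_neg _)] at h1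
    rw [sigmaMinusH, if_neg s.succ_ne_zero, h1]

/-! ### Determinant identities -/

/-- Reversing rows and columns simultaneously does not change the sign. -/
theorem schurDet_eq_det_index {R : Type*} [CommRing R] {r : ℕ} (lam : Ptn r) (G : ℤ → R) :
    schurDet lam G = Matrix.det (Matrix.of fun l k : Fin r => G ((lam.index k : ℤ) - (l : ℤ))) := by
  rw [schurDet, ← Matrix.det_submatrix_equiv_self (Fin.revPerm : Equiv.Perm (Fin r))]
  congr 1
  ext1 i j
  simp only [Matrix.submatrix_apply, Matrix.of_apply, Fin.revPerm_apply, Ptn.index]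
  congr 1
  simp only [Fin.val_rev]
  have := i.isLt
  have := j.isLt
  omega

/-- Add z^i times column i to column 0. Since z^l - x z^{l+1} = 0, only the top entry ∑ eᵢ z^i
remains there, and the complementary minor is lower triangular with diagonal -x. -/
theorem det_bidiagonal_cons {R : Type*} [CommRing R] (s : ℕ) {x z : R} (hxz : x * z = 1)
    (e : Fin (s + 1) → R) :
    Matrix.det (Matrix.of (Fin.cons (α := fun _ => Fin (s + 1) → R) e fun (l : Fin s) i =>
      (if i = l.castSucc then 1 else 0) + if i = l.succ then -x else 0)) =
      (∑ i, e i * z ^ (i : ℕ)) * (-x) ^ s := by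
  set A := Matrix.of (Fin.cons (α := fun _ => Fin (s + 1) → R) e fun (l : Fin s) i =>
      (if i = l.castSucc then 1 else 0) + if i = l.succ then -x else 0) with hA
  have h1 := Matrix.det_updateCol_sum A 0 fun i => z ^ (i : ℕ)
  rw [Fin.val_zero, pow_zero, one_smul] at h1
  rw [← h1, Matrix.det_succ_column_zero, Fin.sum_univ_succ, Finset.sum_eq_zero, add_zero]
  · simp only [Fin.val_zero, pow_zero, one_mul, Matrix.updateCol_self, smul_eq_mul]
    congr 1
    · exact Finset.sum_congr rfl fun i _ => mul_comm _ _
    · rw [Matrix.det_of_isLowerTriangular]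
      · rw [← Fin.prod_const]
        refine Finset.prod_congr rfl fun i _ => ?_
        simp [hA, Fin.succ_ne_zero, (Fin.castSucc_lt_succ (i := i)).ne']
      · intro i j hij
        have hij' : i < j := hij
        have h2 : j.succ ≠ i.castSucc := by
          intro h; have := congrArg Fin.val h; simp at this; omega
        have h3 : j ≠ i := hij'.ne'
        simp [hA, Fin.succ_ne_zero, h2, h3]
  · intro l _
    have h2 : ∑ i : Fin (s + 1), z ^ (i : ℕ) • A l.succ i = 0 := by
      simp only [hA, Matrix.of_apply, Fin.cons_succ, smul_eq_mul, mul_add, Finset.sum_add_distrib,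
        mul_ite, mul_one, mul_zero, Finset.sum_ite_eq', Finset.mem_univ, if_true,
        Fin.val_castSucc, Fin.val_succ]
      linear_combination (-z ^ (l : ℕ)) * hxz
    rw [Matrix.updateCol_self, h2, mul_zero, zero_mul]

/-- Multiply the matrix of G on the left by the matrix of `det_bidiagonal_cons`: the top row becomes
x^{f_k}, and each other row, being row l minus x times row l + 1, becomes a row of H. Then expand
along the top row. -/
theorem det_tail_mul {R : Type*} [CommRing R] (s : ℕ) {x z : R} (hxz : x * z = 1)
    (e : Fin (s + 1) → R) (G H : ℤ → R) (hGH : ∀ n, G n - x * G (n - 1) = H n)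
    (f : Fin (s + 1) → ℕ)
    (he : ∀ j, ∑ i, e i * G ((f j : ℤ) - (i : ℕ)) = x ^ f j) :
    (∑ i, e i * z ^ (i : ℕ)) * Matrix.det (Matrix.of fun l k : Fin (s + 1) =>
        G ((f k : ℤ) - (l : ℤ))) =
      (-z) ^ s * ∑ j : Fin (s + 1), (-1) ^ (j : ℕ) * x ^ f j * Matrix.det (Matrix.of fun l k : Fin s =>
        H ((f (j.succAbove k) : ℤ) - (l : ℤ))) := by
  have h1 : (-z) ^ s * (-x) ^ s = 1 := by rw [← mul_pow, neg_mul_neg, mul_comm, hxz, one_pow]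
  have h2 : Matrix.det (Matrix.of (Fin.cons (α := fun _ => Fin (s + 1) → R) (fun k => x ^ f k)
      fun (l : Fin s) k => H ((f k : ℤ) - (l : ℤ)))) =
      ((∑ i, e i * z ^ (i : ℕ)) * (-x) ^ s) * Matrix.det (Matrix.of fun l k : Fin (s + 1) =>
        G ((f k : ℤ) - (l : ℤ))) := by
    rw [← det_bidiagonal_cons s hxz e, ← Matrix.det_mul]
    congr 1
    ext1 l k
    rw [Matrix.mul_apply]
    induction l using Fin.cases with
    | zero => simp [← he]
    | succ l =>
      simp only [Matrix.of_apply, Fin.cons_succ, add_mul, ite_mul, one_mul, zero_mul,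
        Finset.sum_add_distrib, Finset.sum_ite_eq', Finset.mem_univ, if_true, Fin.val_castSucc,
        Fin.val_succ, ← hGH]
      push_cast
      rw [sub_sub, neg_mul, sub_eq_add_neg]
  rw [Matrix.det_succ_row_zero] at h2
  calc _ = ((-z) ^ s * (-x) ^ s) * ((∑ i, e i * z ^ (i : ℕ)) *
        Matrix.det (Matrix.of fun l k : Fin (s + 1) => G ((f k : ℤ) - (l : ℤ)))) := by
          rw [h1, one_mul]
    _ = (-z) ^ s * (((∑ i, e i * z ^ (i : ℕ)) * (-x) ^ s) *
        Matrix.det (Matrix.of fun l k : Fin (s + 1) => G ((f k : ℤ) - (l : ℤ)))) := by ring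
    _ = _ := by
      rw [← h2]
      rfl

theorem det_of_first_column {R : Type*} [CommRing R] {n : ℕ} (A : Matrix (Fin (n + 1)) (Fin (n + 1)) R)
    (hA : ∀ i : Fin n, A i.succ 0 = 0) :
    A.det = A 0 0 * (A.submatrix Fin.succ Fin.succ).det := by
  rw [Matrix.det_succ_column_zero, Fin.sum_univ_succ, Finset.sum_eq_zero, add_zero]
  · simp
  · intro i _
    rw [hA, mul_zero, zero_mul]

/-- Both determinants reduce to the r × r determinant of N. On the left the index 0 makes the first
column (1, 0, …, 0). On the right, subtracting z times the preceding row clears the first column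
below q and leaves -z N. -/
theorem det_shift_mul {R : Type*} [CommRing R] (r : ℕ) {x z : R} (hxz : x * z = 1) (q : R)
    (H : ℤ → R) (hH0 : H 0 = 1) (hH : ∀ m < 0, H m = 0) (g : Fin r → ℕ) :
    q * Matrix.det (Matrix.of fun l k : Fin (r + 1) =>
      H (((Fin.cons (α := fun _ => ℕ) 0 (fun k => g k + 1) k : ℕ) : ℤ) - (l : ℤ)) -
        x * H (((Fin.cons (α := fun _ => ℕ) 0 (fun k => g k + 1) k : ℕ) : ℤ) - 1 - (l : ℤ))) =
      (-x) ^ r * Matrix.det (Matrix.of fun l : Fin (r + 1) =>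
        Fin.cons (α := fun _ => R) (z ^ (l : ℕ) * q) fun k => H ((g k : ℤ) - (l : ℤ))) := by
  have h1 : (-x) ^ r * (-z) ^ r = 1 := by rw [← mul_pow, neg_mul_neg, hxz, one_pow]
  set N : Matrix (Fin r) (Fin r) R :=
    Matrix.of fun l k => H ((g k : ℤ) - (l : ℤ)) - x * H ((g k : ℤ) - 1 - (l : ℤ)) with hN
  have h2 : Matrix.det (Matrix.of fun l : Fin (r + 1) =>
      Fin.cons (α := fun _ => R) (z ^ (l : ℕ) * q) fun k => H ((g k : ℤ) - (l : ℤ))) =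
      Matrix.det (Matrix.of (Fin.cons (α := fun _ => Fin (r + 1) → R)
        (Fin.cons (α := fun _ => R) q fun k => H (g k)) fun l : Fin r =>
          Fin.cons (α := fun _ => R) 0 ((-z) • N l))) := by
    refine Matrix.det_eq_of_forall_row_eq_smul_add_pred (fun _ => z) (fun k => ?_) fun l k => ?_
    · induction k using Fin.cases <;> simp
    · induction k using Fin.cases with
      | zero => simp; ring
      | succ k =>
        simp only [hN, Matrix.of_apply, Fin.cons_succ, Fin.val_succ, Pi.smul_apply, smul_eq_mul,
          Fin.val_castSucc]
        have h3 : (g k : ℤ) - ((l : ℕ) + 1 : ℕ) = (g k : ℤ) - 1 - (l : ℤ) := by push_cast; ring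
        rw [h3]
        linear_combination (-H ((g k : ℤ) - 1 - (l : ℤ))) * hxz
  rw [h2, det_of_first_column _ (by
    intro i
    rw [Matrix.of_apply, Fin.cons_zero, hH _ (by rw [Fin.val_succ]; push_cast; omega), hH _ (by rw [Fin.val_succ]; push_cast; omega)]
    simp), det_of_first_column _ (by intro i; simp)]
  have h3 : (Matrix.of (Fin.cons (α := fun _ => Fin (r + 1) → R)
        (Fin.cons (α := fun _ => R) q fun k => H (g k)) fun l : Fin r =>
          Fin.cons (α := fun _ => R) 0 ((-z) • N l))).submatrix Fin.succ Fin.succ = (-z) • N := by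
    ext1 l k
    simp
  have h4 : (Matrix.of fun l k : Fin (r + 1) =>
      H (((Fin.cons (α := fun _ => ℕ) 0 (fun k => g k + 1) k : ℕ) : ℤ) - (l : ℤ)) -
        x * H (((Fin.cons (α := fun _ => ℕ) 0 (fun k => g k + 1) k : ℕ) : ℤ) - 1 -
          (l : ℤ))).submatrix Fin.succ Fin.succ = N := by
    ext1 l k
    simp only [hN, Matrix.submatrix_apply, Matrix.of_apply, Fin.cons_succ, Fin.val_succ]
    push_cast
    congr 2
    · ring
    · congr 1
      ring
  rw [h3, h4, Matrix.det_smul, Fintype.card_fin]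
  simp only [Matrix.of_apply, Fin.cons_zero, Fin.val_zero, Nat.cast_zero, sub_zero, hH0,
    hH (0 - 1) (by norm_num), mul_zero, one_mul]
  linear_combination (-(q * N.det)) * h1

/-! ### The two factors of the residue -/

theorem coeff_E_of_lt (s : ℕ) {n : ℕ} (hn : s < n) : PowerSeries.coeff n (E s) = 0 := by
  rw [E, map_add, map_sum, PowerSeries.coeff_one, if_neg (by omega), zero_add]
  refine Finset.sum_eq_zero fun j _ => ?_
  rw [PowerSeries.coeff_monomial, if_neg (by omega)]

theorem sum_coeff_E_mul_h (s : ℕ) (n : ℤ) :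
    ∑ i : Fin (s + 1), PowerSeries.coeff (i : ℕ) (E s) * h s (n - (i : ℕ)) =
      if n = 0 then 1 else 0 := by
  rcases lt_or_ge n 0 with hn | hn
  · rw [if_neg hn.ne]
    exact Finset.sum_eq_zero fun i _ => by rw [h_neg s (by omega), mul_zero]
  lift n to ℕ using hn
  have h1 := congrArg (PowerSeries.coeff n) (E_mul_invE s)
  rw [PowerSeries.coeff_mul, Finset.Nat.sum_antidiagonal_eq_sum_range_succ_mk,
    PowerSeries.coeff_one] at h1
  rw [Fin.sum_univ_eq_sum_range (fun i => PowerSeries.coeff i (E s) * h s ((n : ℤ) - (i : ℤ)))]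
  simp only [Nat.cast_eq_zero]
  rw [← h1]
  have h2 : ∀ k ∈ Finset.range n.succ, PowerSeries.coeff k (E s) *
      PowerSeries.coeff (n - k) (invE s) = PowerSeries.coeff k (E s) * h s ((n : ℤ) - (k : ℤ)) := by
    intro k hk
    rw [Finset.mem_range] at hk
    rw [← h_natCast, Nat.cast_sub (by omega)]
  rw [Finset.sum_congr rfl h2]
  -- Both sums are extended to a common range; the new terms vanish because E_s has degree at most s
  -- and h is zero at negative indices.
  rw [Finset.sum_subset (Finset.range_mono (show s + 1 ≤ s + n + 1 by omega)),
    Finset.sum_subset (Finset.range_mono (show n + 1 ≤ s + n + 1 by omega))]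
  · intro k _ hk
    rw [Finset.mem_range] at hk
    rw [h_neg s (by omega), mul_zero]
  · intro k _ hk
    rw [Finset.mem_range] at hk
    rw [coeff_E_of_lt s (by omega), zero_mul]

theorem E_eq_sum (s : ℕ) : E s = ∑ i : Fin (s + 1),
    PowerSeries.C (PowerSeries.coeff (i : ℕ) (E s)) * PowerSeries.X ^ (i : ℕ) := by
  ext1 n
  rw [map_sum, Fin.sum_univ_eq_sum_range (fun i => PowerSeries.coeff n
    (PowerSeries.C (PowerSeries.coeff i (E s)) * PowerSeries.X ^ i))]
  simp_rw [PowerSeries.coeff_C_mul, PowerSeries.coeff_X_pow, mul_ite, mul_one, mul_zero]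
  rw [Finset.sum_ite_eq]
  split_ifs with hn
  · rfl
  · rw [Finset.mem_range] at hn
    exact coeff_E_of_lt s (by omega)

theorem single_neg_one_mul_single_one (R : Type*) [CommRing R] :
    (HahnSeries.single (-1 : ℤ) (1 : R)) * HahnSeries.single (1 : ℤ) (1 : R) = 1 := by
  rw [HahnSeries.single_mul_single, mul_one, neg_add_cancel]
  rfl

theorem neg_one_pow_eq_single (R : Type*) [CommRing R] (n : ℕ) :
    (-1 : LaurentSeries R) ^ n = HahnSeries.single 0 ((-1) ^ n) := by
  rw [← HahnSeries.C_apply, map_pow, map_neg, map_one]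

theorem invLaurent_C {R : Type*} [CommRing R] (a : R) :
    invLaurent (Polynomial.C a) = HahnSeries.C a := by simp [invLaurent]

theorem invLaurent_X {R : Type*} [CommRing R] :
    invLaurent (Polynomial.X : Polynomial R) = HahnSeries.single (-1) 1 := by simp [invLaurent]

/-- This is `det_tail_mul` with x = z^{-1} and G the tails ∑ h_{n-i} z^{-i}. Consecutive tails
telescope to h_n, and E_s · (1/E_s) = 1 collapses the combination with coefficients of E_s to
z^{-n}. -/
theorem E_mul_schurDet_sigmaMinusH (s : ℕ) (lam : Ptn (s + 1)) :
    HahnSeries.ofPowerSeries ℤ (B s) (E s) * invLaurent (schurDet lam (sigmaMinusH s)) =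
      ∑ j : Fin (s + 1), HahnSeries.single ((s : ℤ) - lam.index j)
        ((-1) ^ (s + j : ℕ) * hDet s (lam.index ∘ j.succAbove)) := by
  have h1 := det_tail_mul s (single_neg_one_mul_single_one (B s))
    (fun i => HahnSeries.C (PowerSeries.coeff (i : ℕ) (E s)))
    (fun n => invLaurent (hTail s n)) (fun n => HahnSeries.C (h s n))
    (fun n => by
      rw [← invLaurent_X, ← invLaurent_C, ← map_mul, ← map_sub]
      congr 1
      ext1 i
      rcases i with _ | i
      · simp [coeff_hTail]
      · rw [Polynomial.coeff_sub, Polynomial.coeff_X_mul, coeff_hTail, coeff_hTail,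
          Polynomial.coeff_C_succ, sub_eq_zero]
        congr 1
        push_cast
        ring)
    lam.index
    (fun j => by
      rw [← invLaurent_X, ← map_pow]
      simp_rw [← invLaurent_C, ← map_mul]
      rw [← map_sum]
      congr 1
      ext1 k
      rw [Polynomial.finsetSum_coeff, Polynomial.coeff_X_pow]
      simp_rw [Polynomial.coeff_C_mul, coeff_hTail, sub_right_comm]
      rw [sum_coeff_E_mul_h]
      congr 1
      simp only [eq_iff_iff]
      omega)
  have h2 : HahnSeries.ofPowerSeries ℤ (B s) (E s) = ∑ i : Fin (s + 1),
      HahnSeries.C (PowerSeries.coeff (i : ℕ) (E s)) * HahnSeries.single (1 : ℤ) (1 : B s) ^ (i : ℕ) := by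
    conv_lhs => rw [E_eq_sum]
    simp [HahnSeries.ofPowerSeries_X]
  have h3 : invLaurent (schurDet lam (sigmaMinusH s)) = Matrix.det (Matrix.of
      fun l k : Fin (s + 1) => invLaurent (hTail s ((lam.index k : ℤ) - (l : ℤ)))) := by
    rw [schurDet_eq_det_index, RingHom.map_det]
    simp_rw [sigmaMinusH_eq_hTail]
    rfl
  rw [h2, h3]
  refine h1.trans ?_
  rw [Finset.mul_sum]
  refine Finset.sum_congr rfl fun j _ => ?_
  have h4 : Matrix.det (Matrix.of fun l k : Fin s =>
      (HahnSeries.C (h s ((lam.index (j.succAbove k) : ℤ) - (l : ℤ))) : LaurentSeries (B s))) =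
      HahnSeries.single 0 (hDet s (lam.index ∘ j.succAbove)) := by
    change _ = HahnSeries.C _
    rw [hDet, RingHom.map_det]
    rfl
  rw [h4, neg_pow, neg_one_pow_eq_single, neg_one_pow_eq_single, HahnSeries.single_pow, HahnSeries.single_pow]
  simp only [HahnSeries.single_mul_single, one_pow, mul_one]
  congr 1
  · congr 1
    simp only [nsmul_eq_mul]
    ring
  · ring

theorem Ptn.index_succ {r : ℕ} (mu : Ptn r) :
    mu.succ.index = Fin.cons (α := fun _ => ℕ) 0 fun k => mu.index k + 1 := by
  funext k
  induction k using Fin.cases with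
  | zero => simp [Ptn.index, Ptn.succ]
  | succ k =>
    rw [Fin.cons_succ, Ptn.index, Ptn.index, Ptn.succ]
    simp only [Fin.rev_succ, Fin.snoc_castSucc, Fin.val_succ]
    omega

/-- Apply `det_shift_mul` with q = 1/E_{r+1}(z). The first column then has entries z^l q, whose
coefficient at z^i is h_{i-l}: exactly a Jacobi–Trudi column of index i. The factor (-z^{-1})^r
accounts for the sign and for the shift of the exponent by r. -/
theorem coeff_invE_mul_sigmaBarMinusB (r : ℕ) (mu : Ptn r) (i : ℕ) :
    (HahnSeries.ofPowerSeries ℤ (B (r + 1)) (invE (r + 1)) *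
      invLaurent (sigmaBarMinusB (r + 1) (schurDet mu.succ (h (r + 1))))).coeff ((i : ℤ) - r) =
      (-1) ^ r * hDet (r + 1) (Fin.cons (α := fun _ => ℕ) i mu.index) := by
  have h1 := det_shift_mul r (single_neg_one_mul_single_one (B (r + 1)))
    (HahnSeries.ofPowerSeries ℤ (B (r + 1)) (invE (r + 1)))
    (fun n => HahnSeries.C (h (r + 1) n)) (by rw [h_zero, map_one])
    (fun m hm => by rw [h_neg _ hm, map_zero]) mu.index
  have h2 : invLaurent (sigmaBarMinusB (r + 1) (schurDet mu.succ (h (r + 1)))) =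
      Matrix.det (Matrix.of fun l k : Fin (r + 1) =>
        (HahnSeries.C (h (r + 1) (((Fin.cons (α := fun _ => ℕ) 0 (fun k => mu.index k + 1) k : ℕ) : ℤ) -
          (l : ℤ))) : LaurentSeries (B (r + 1))) - HahnSeries.single (-1 : ℤ) 1 *
        HahnSeries.C (h (r + 1) (((Fin.cons (α := fun _ => ℕ) 0 (fun k => mu.index k + 1) k : ℕ) : ℤ) -
          1 - (l : ℤ)))) := by
    rw [← hDet_index, sigmaBarMinusB_hDet, RingHom.map_det, Ptn.index_succ]
    congr 1
    ext1 l k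
    simp only [RingHom.mapMatrix_apply, Matrix.map_apply, Matrix.of_apply, map_sub, map_mul,
      invLaurent_C, invLaurent_X]
  have h3 : (-(HahnSeries.single (-1 : ℤ) (1 : B (r + 1)))) ^ r =
      HahnSeries.single (-(r : ℤ)) ((-1) ^ r) := by
    rw [← HahnSeries.single_neg, HahnSeries.single_pow]
    simp
  rw [h2, h1, h3, HahnSeries.coeff_single_mul, sub_neg_eq_add, sub_add_cancel]
  congr 1
  -- Only the first column depends on z, so expanding along it lets the coefficient be taken term by
  -- term.
  rw [Matrix.det_succ_column_zero, hDet, Matrix.det_succ_column_zero, HahnSeries.coeff_sum]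
  refine Finset.sum_congr rfl fun l _ => ?_
  have h4 : ((Matrix.of fun l : Fin (r + 1) => Fin.cons (α := fun _ => LaurentSeries (B (r + 1)))
      (HahnSeries.single (1 : ℤ) 1 ^ (l : ℕ) *
        HahnSeries.ofPowerSeries ℤ (B (r + 1)) (invE (r + 1)))
      fun k => HahnSeries.C (h (r + 1) ((mu.index k : ℤ) - (l : ℤ)))).submatrix
        l.succAbove Fin.succ).det = HahnSeries.C ((Matrix.of fun l b : Fin (r + 1) =>
          h (r + 1) (((Fin.cons (α := fun _ => ℕ) i mu.index b : ℕ) : ℤ) - (l : ℤ))).submatrix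
            l.succAbove Fin.succ).det := by
    rw [RingHom.map_det]
    rfl
  rw [h4, neg_one_pow_eq_single, HahnSeries.C_apply, HahnSeries.coeff_mul_single_zero,
    HahnSeries.coeff_single_zero_mul, Matrix.of_apply, Fin.cons_zero, HahnSeries.single_pow, one_pow,
    HahnSeries.coeff_single_mul, one_mul, Matrix.of_apply, Fin.cons_zero, PowerSeries.coeff_coe, h]
  congr 2
  simp only [nsmul_eq_mul, mul_one]
  rcases lt_or_ge ((i : ℤ) - (l : ℕ)) 0 with h5 | h5
  · rw [if_pos h5, if_neg (not_le.mpr h5)]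
  · rw [if_neg (not_lt.mpr h5), if_pos h5]
    congr 2
    omega

/-! ### The residue as the Plücker form. -/

theorem res_tensorSeries_sum_single {R S : Type*} [CommRing R] [CommRing S] {n : ℕ}
    (k : Fin n → ℤ) (x : Fin n → R) (g : LaurentSeries S) :
    res (tensorSeries (∑ j, HahnSeries.single (k j) (x j)) g) =
      ∑ j, x j ⊗ₜ[ℤ] g.coeff (-1 - k j) := by
  have h1 : (∑ j, HahnSeries.single (k j) (x j) : LaurentSeries R).map
      (Algebra.TensorProduct.includeLeft : R →ₐ[ℤ] R ⊗[ℤ] S) =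
      ∑ j, HahnSeries.single (k j) (x j ⊗ₜ[ℤ] (1 : S)) := by
    ext1
    funext i
    rw [HahnSeries.map_coeff, HahnSeries.coeff_sum, HahnSeries.coeff_sum, map_sum]
    refine Finset.sum_congr rfl fun j _ => ?_
    rw [HahnSeries.coeff_single, HahnSeries.coeff_single]
    split_ifs <;> simp
  rw [res, tensorSeries, h1, Finset.sum_mul, HahnSeries.coeff_sum]
  refine Finset.sum_congr rfl fun j _ => ?_
  rw [HahnSeries.coeff_single_mul, HahnSeries.map_coeff, Algebra.TensorProduct.includeRight_apply,
    Algebra.TensorProduct.tmul_mul_tmul, mul_one, one_mul]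

/-- The embedding `B_s ⊗ B_t → ⋀ M₀ ⊗ ⋀ M₀` given by `φ_s ⊗ φ_t`. -/
def phiTensor (s t : ℕ) : B s ⊗[ℤ] B t →ₗ[ℤ] ExtM0 ⊗[ℤ] ExtM0 :=
  TensorProduct.map ((Submodule.subtype _).comp (phi s).toLinearMap)
    ((Submodule.subtype _).comp (phi t).toLinearMap)

/-- Flatness over ℤ keeps the tensor product of two injections injective, so the residue may be
tested for vanishing in ⋀M₀ ⊗ ⋀M₀. -/
theorem phiTensor_injective (s t : ℕ) : Function.Injective (phiTensor s t) :=
  TensorProduct.map_injective_of_flat_flat _ _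
    (Subtype.val_injective.comp (phi s).injective) (Subtype.val_injective.comp (phi t).injective)

theorem phiTensor_tmul (s t : ℕ) (p : B s) (q : B t) :
    phiTensor s t (p ⊗ₜ q) = (phi s p : ExtM0) ⊗ₜ (phi t q : ExtM0) := rfl

theorem phiTensor_res (s : ℕ) (lam mu : Ptn (s + 1)) :
    phiTensor s (s + 2) (res (tensorSeries
      (HahnSeries.ofPowerSeries ℤ (B s) (E s) * invLaurent (schurDet lam (sigmaMinusH s)))
      (HahnSeries.ofPowerSeries ℤ (B (s + 2)) (invE (s + 2)) *
        invLaurent (sigmaBarMinusB (s + 2) (schurDet mu.succ (h (s + 2))))))) =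
      - plucker (bWedge lam : ExtM0) (bWedge mu : ExtM0) := by
  rw [E_mul_schurDet_sigmaMinusH, res_tensorSeries_sum_single, map_sum, bWedge,
    exteriorPower.ιMulti_apply_coe, plucker_ιMulti, ← Finset.sum_neg_distrib]
  refine Finset.sum_congr rfl fun j _ => ?_
  -- The exponent complementary to s - f_j in the residue is f_j - r with r = s + 1, so the inserted
  -- index is the deleted one.
  have h1 : (-1 : ℤ) - ((s : ℤ) - lam.index j) = (lam.index j : ℤ) - (s + 1 : ℕ) := by
    push_cast
    ring
  have h2 : ∀ {t : ℕ} (n : ℕ) (p : B t), (-1) ^ n * p = (-1 : ℤ) ^ n • p := by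
    intro t n p
    rw [zsmul_eq_mul]
    push_cast
    rfl
  -- The signs of the two factors combine to the sign of the Plücker expansion, up to the global
  -- minus.
  have h3 : (-1 : ℤ) ^ (s + j : ℕ) * (-1) ^ (s + 1) = -(-1) ^ (j : ℕ) := by
    have : (-1 : ℤ) ^ s * (-1) ^ s = 1 := by rw [← mul_pow]; simp
    rw [pow_add, pow_succ]
    linear_combination (-(-1) ^ (j : ℕ)) * this
  have h4 : (phi (s + 2) (hDet (s + 2) (Fin.cons (α := fun _ => ℕ) (lam.index j) mu.index)) : ExtM0) =
      ExteriorAlgebra.ι ℤ (b (lam.index j)) * (bWedge mu : ExtM0) := by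
    rw [phi_hDet, exteriorPower.ιMulti_apply_coe, ExteriorAlgebra.ιMulti_succ_apply]
    rfl
  rw [h1, coeff_invE_mul_sigmaBarMinusB, h2, h2, TensorProduct.tmul_smul, TensorProduct.smul_tmul',
    smul_smul, mul_comm, h3, ← TensorProduct.smul_tmul', map_smul, phiTensor_tmul, h4, phi_hDet, neg_smul]
  rfl

/-- The residue as an additive map. -/
def resHom (R : Type*) [CommRing R] : LaurentSeries R →+ R where
  toFun := res
  map_zero' := rfl
  map_add' _ _ := rfl

end

end SchubertCone

theorem mainTheorem2 (r : ℕ) (hr : 1 ≤ r) (a : Ptn r →₀ ℤ) :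
    (a.sum fun lam c => c • bWedge lam) ∈ grassmannCone r ↔
      res (a.sum fun lam c => a.sum fun mu d =>
        (c * d) • tensorSeries
          (HahnSeries.ofPowerSeries ℤ (B (r - 1)) (E (r - 1)) *
            invLaurent (schurDet lam (sigmaMinusH (r - 1))))
          (HahnSeries.ofPowerSeries ℤ (B (r + 1)) (invE (r + 1)) *
            invLaurent (sigmaBarMinusB (r + 1) (schurDet mu.succ (h (r + 1)))))) = 0 := by
  obtain ⟨s, rfl⟩ : ∃ s, r = s + 1 := ⟨r - 1, by omega⟩
  rw [mem_grassmannCone_iff, ← neg_eq_zero, ← (phiTensor_injective s (s + 2)).eq_iff, map_zero]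
  -- Only bilinear expansion remains, and it works for any family T with the prescribed residues.
  suffices hkey : ∀ T : Ptn (s + 1) → Ptn (s + 1) → LaurentSeries (B s ⊗[ℤ] B (s + 2)),
      (∀ lam mu, phiTensor s (s + 2) (res (T lam mu)) =
        - plucker (bWedge lam : ExtM0) (bWedge mu : ExtM0)) →
      phiTensor s (s + 2) (res (a.sum fun lam c => a.sum fun mu d => (c * d) • T lam mu)) =
        - plucker ((a.sum fun lam c => c • bWedge lam : ⋀[ℤ]^(s + 1) M0) : ExtM0)
          ((a.sum fun lam c => c • bWedge lam : ⋀[ℤ]^(s + 1) M0) : ExtM0) by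
    exact Eq.congr_left (hkey _ (phiTensor_res s)).symm
  intro T hT
  have h1 : ((a.sum fun lam c => c • bWedge lam : ⋀[ℤ]^(s + 1) M0) : ExtM0) =
      ∑ lam ∈ a.support, a lam • (bWedge lam : ExtM0) := by
    rw [Finsupp.sum, Submodule.coe_sum]
    rfl
  have h2 : ∀ y : ExtM0, plucker (∑ lam ∈ a.support, a lam • (bWedge lam : ExtM0)) y =
      ∑ lam ∈ a.support, a lam • plucker (bWedge lam : ExtM0) y := by
    intro y
    rw [map_sum, LinearMap.sum_apply]
    exact Finset.sum_congr rfl fun lam _ => by rw [map_smul, LinearMap.smul_apply]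
  change phiTensor s (s + 2) (resHom _ _) = _
  rw [h1, h2, Finsupp.sum, map_sum, map_sum, ← Finset.sum_neg_distrib]
  refine Finset.sum_congr rfl fun lam _ => ?_
  rw [Finsupp.sum, map_sum, map_sum, map_sum, Finset.smul_sum, ← Finset.sum_neg_distrib]
  refine Finset.sum_congr rfl fun mu _ => ?_
  rw [map_zsmul, map_zsmul, map_smul, smul_smul, ← smul_neg, ← hT]
  rfl
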